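/- Hashing with coalesced chains. Let $0<n\le m$. Items $x_1,\dots,x_n$ are inserted one after another into a table with cells $1,\dots,m$, all initially empty and with null link fields, using hash addresses $h_1,\dots,h_n\in\{1,\dots,m\}$. If cell $h_i$ is empty, $x_i$ is stored there. Otherwise $x_i$ is stored in the empty cell $e$ of largest index, and $e$ is linked into the chain of $h_i$: under late insertion ($\mathsf L$) at the end of the chain reached by following the links from $h_i$; under early insertion ($\mathsf E$) immediately after $h_i$ (the link of $e$ is set to the old link of $h_i$, and the link of $h_i$ is set to $e$). Let $\mathcal T_{m,n}$ be the random table obtained when $h_1,\dots,h_n$ are independent and uniform on $\{1,\dots,m\}$. For $\Xi\in\{\mathsf L,\mathsf E\}$ let $d_i^{\Xi}$ be the number of links followed from $h_i$ until $x_i$ is found in the final table built with policy $\Xi$, let $n_k^\Xi=\#\{i\le n: d_i^\Xi=k\}$, and let $d^\Xi(\mathcal T_{m,n})=d_I^\Xi$, where $I$ is uniform on $\{1,\dots,n\}$ and independent of the hash addresses. Let $d_j^{\mathsf U}$ be the number of occupied cells encountered in an unsuccessful search starting at cell $j$ (in the final table built with either of the two policies), let $n_k^{\mathsf U}=\#\{j\le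 m: d_j^{\mathsf U}=k\}$, and let $d^{\mathsf U}(\mathcal T_{m,n})=d_J^{\mathsf U}$, where $J$ is uniform on $\{1,\dots,m\}$ and independent of the hash addresses. For $\alpha\in[0,1]$ put $$p^{\mathsf U}_\alpha(0)=1-\alpha,\qquad p^{\mathsf U}_\alpha(k)=\int_0^\alpha(1-\alpha+t)(1-e^{-t})^{k-1}\,dt\quad(k\ge1),$$ $$p^{\mathsf L}_\alpha(0)=1-\tfrac{\alpha}{2},\qquad p^{\mathsf L}_\alpha(k)=\frac1\alpha\int_0^\alpha\Bigl(\alpha-t-\tfrac{(\alpha-t)^2}{2}\Bigr)(1-e^{-t})^{k-1}\,dt\quad(k\ge1),$$ $$p^{\mathsf E}_\alpha(0)=1-\tfrac{\alpha}{2},\qquad p^{\mathsf E}_\alpha(k)=\frac1\alpha\int_0^\alpha(\alpha-t)e^{-t}(1-e^{-t})^{k-1}\,dt\quad(k\ge1),$$ where $p^{\mathsf L}_0(k)=p^{\mathsf E}_0(k)=0$ for $k\ge1$. Theorem. For every $\Xi\in\{\mathsf L,\mathsf E,\mathsf U\}$ and $\alpha\in[0,1]$, $(p^\Xi_\alpha(k))_{k\ge0}$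 is a probability distribution on $\mathbb N=\{0,1,\dots\}$. Suppose that $m,n\to\infty$ with $0<n\le m$ and $n/m\to\alpha\in[0,1]$. Then, for every $k=0,1,\dots$, $$\Pr\bigl(d^{\mathsf U}(\mathcal T_{m,n})=k\bigr)=\tfrac1m\,\mathbb E\,n_k^{\mathsf U}(\mathcal T_{m,n})\to p_\alpha^{\mathsf U}(k),\qquad \Pr\bigl(d^{\Xi}(\mathcal T_{m,n})=k\bigr)=\tfrac1n\,\mathbb E\,n_k^{\Xi}(\mathcal T_{m,n})\to p_\alpha^{\Xi}(k)\quad(\Xi\in\{\mathsf L,\mathsf E\}).$$ Moreover, for every $\Xi\in\{\mathsf L,\mathsf E,\mathsf U\}$, if $D^\Xi_\alpha$ is a random variable with distribution $p^\Xi_\alpha$, then $d^\Xi(\mathcal T_{m,n})$ converges in distribution to $D^\Xi_\alpha$, and all moments converge: for every real $r\ge0$, $\mathbb E (D^\Xi_\alpha)^r<\infty$ and $\mathbb E\bigl(d^\Xi(\mathcal T_{m,n})\bigr)^r\to\mathbb E(D^\Xi_\alpha)^r$. -/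

import Mathlib

open Filter Topology MeasureTheory ProbabilityTheory

namespace CoalescedHashing

/-- The two insertion policies: late insertion and early insertion. -/
inductive Policy
  | late
  | early

/-- A table with cells `Fin m` for items `Fin n`: the item stored in each cell (`none` for an empty
cell) and the link field of each cell (`none` for a null link). -/
structure Table (m n : ℕ) where
  item : Fin m → Option (Fin n)
  link : Fin m → Option (Fin m)

namespace Table

variable {m n : ℕ}

/-- The initial table: all cells empty, all links null. -/
def empty (m n : ℕ) : Table m n := ⟨fun _ => none, fun _ => none⟩

/-- The cell reached from cell `c` after following `d` links, if there are so many. -/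
def walk (T : Table m n) : ℕ → Fin m → Option (Fin m)
  | 0, c => some c
  | d + 1, c => (T.link c).bind (T.walk d)

/-- The last cell of the chain through `c`: follow the link as long as it is not null. A chain has
at most `m` cells, so `m` steps always reach its end. -/
def chainEnd (T : Table m n) (c : Fin m) : Fin m :=
  (fun a => (T.link a).getD a)^[m] c

/-- The empty cell with largest index, if there is an empty cell. -/
def freeCell (T : Table m n) : Option (Fin m) :=
  (Finset.univ.filter fun c => T.item c = none).max

/-- Store item `i` in the empty cell `e` and link this cell into the chain immediately after the
cell `c`. -/
def storeAfter (T : Table m n) (i : Fin n) (c e : Fin m) : Table m n where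
  item := Function.update T.item e (some i)
  link := Function.update (Function.update T.link e (T.link c)) c (some e)

/-- Insertion of item `i` with hash address `a`. If cell `a` is empty, the item is put there.
Otherwise it is put into the empty cell with largest index, and that cell is linked into the chain
of `a`: at the end of the chain for late insertion, immediately after `a` for early insertion.
(A full table is left unchanged; this does not happen when at most `m` items are inserted.) -/
def insert (Ξ : Policy) (T : Table m n) (i : Fin n) (a : Fin m) : Table m n :=
  if T.item a = none then
    { T with item := Function.update T.item a (some i) }
  else
    match T.freeCell with
    | none => T
    | some e =>
      match Ξ with
      | .late => T.storeAfter i (T.chainEnd a) e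
      | .early => T.storeAfter i a e

end Table

/-- The final table after the `n` items with hash addresses `h 0, h 1, …` have been inserted in this
order under the policy `Ξ`. -/
def buildTable (Ξ : Policy) {m n : ℕ} (h : Fin n → Fin m) : Table m n :=
  (List.finRange n).foldl (fun T i => T.insert Ξ i (h i)) (Table.empty m n)

/-- The (final) displacement of item `i`: the number of links to be followed from its hash address
until the item is found. -/
noncomputable def itemDisplacement (Ξ : Policy) {m n : ℕ} (h : Fin n → Fin m) (i : Fin n) : ℕ :=
  sInf {d | ∃ c, (buildTable Ξ h).walk d (h i) = some c ∧ (buildTable Ξ h).item c = some i}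

/-- The number of occupied cells encountered in an unsuccessful search starting at address `j`. -/
noncomputable def unsuccessfulCost (Ξ : Policy) {m n : ℕ} (h : Fin n → Fin m) (j : Fin m) : ℕ :=
  Set.ncard {c | (buildTable Ξ h).item c ≠ none ∧ ∃ d, (buildTable Ξ h).walk d j = some c}

/-- The quantities under study: the displacement of an item under a given policy, and the cost of
an unsuccessful search in the table built under a given policy. -/
inductive Quantity
  | item (Ξ : Policy)
  | unsuccessful (Ξ : Policy)

/-- The number of values of the quantity in a table: one for each item, respectively one for each
address. -/
def Quantity.size (m n : ℕ) : Quantity → ℕ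
  | .item _ => n
  | .unsuccessful _ => m

/-- The number `n_k` of items (respectively addresses) for which the quantity equals `k`. -/
noncomputable def Quantity.count {m n : ℕ} (h : Fin n → Fin m) (k : ℕ) : Quantity → ℕ
  | .item Ξ => Set.ncard {i | itemDisplacement Ξ h i = k}
  | .unsuccessful Ξ => Set.ncard {j | unsuccessfulCost Ξ h j = k}

/-- The sample space: a hash sequence, an item `I` and an address `J`. -/
abbrev Sample (m n : ℕ) : Type := (Fin n → Fin m) × Fin n × Fin m

/-- All elements of the sample space are equally likely: the hash addresses are i.i.d. uniform, and
`I` and `J` are uniform and independent of them. -/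
noncomputable def sampleMeasure (m n : ℕ) : Measure (Sample m n) := uniformOn Set.univ

instance (m n : ℕ) [NeZero m] [NeZero n] : IsProbabilityMeasure (sampleMeasure m n) :=
  isProbabilityMeasure_uniformOn Set.finite_univ Set.univ_nonempty

/-- The value of the quantity for the random item `I` (respectively the random address `J`) in the
random table. -/
noncomputable def Quantity.value {m n : ℕ} (ω : Sample m n) : Quantity → ℕ
  | .item Ξ => itemDisplacement Ξ ω.1 ω.2.1
  | .unsuccessful Ξ => unsuccessfulCost Ξ ω.1 ω.2.2

/-- The limit law for unsuccessful searches. -/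
noncomputable def limitU (α : ℝ) : ℕ → ℝ
  | 0 => 1 - α
  | k + 1 => ∫ t in (0 : ℝ)..α, (1 - α + t) * (1 - Real.exp (-t)) ^ k

/-- The limit law for the displacement under late insertion. -/
noncomputable def limitL (α : ℝ) : ℕ → ℝ
  | 0 => 1 - α / 2
  | k + 1 => if α = 0 then 0 else
      1 / α * ∫ t in (0 : ℝ)..α, (α - t - (α - t) ^ 2 / 2) * (1 - Real.exp (-t)) ^ k

/-- The limit law for the displacement under early insertion. -/
noncomputable def limitE (α : ℝ) : ℕ → ℝ
  | 0 => 1 - α / 2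
  | k + 1 => if α = 0 then 0 else
      1 / α * ∫ t in (0 : ℝ)..α, (α - t) * Real.exp (-t) * (1 - Real.exp (-t)) ^ k

/-- The limit law of a quantity at load factor `α`. -/
noncomputable def Quantity.limit (α : ℝ) : Quantity → ℕ → ℝ
  | .item .late => limitL α
  | .item .early => limitE α
  | .unsuccessful _ => limitU α

end CoalescedHashing

open CoalescedHashing

/-! Every insertion changes search costs in a way that closes up after averaging over the hash
address. Suppose the new cell `e` is spliced in behind a cell `c` (`c = a` for early insertion, `c`
the end of the chain of `a` for late). Then `e` inherits the old cost of `c`, and exactly the cells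
whose chain passes through `c` gain one. Summed over all addresses `a`, a cell of cost `x`
contributes `x * g (x + 1) - (x - 1) * g x - g 0` to the change of `∑ g (cost)`. Under early
insertion this is double counting. Under late insertion it holds only after summing over a whole
chain, whose costs are `1, …, ℓ`, by telescoping. Hence both policies obey the same recursion for
unsuccessful searches (`sum_cost_insert`). A late item starts at the cost of its address and never
moves (`sum_disp_insert_late`); an early item of displacement `d` is pushed back by exactly `d` of
the `m` addresses (`sum_disp_insert_early`).

Taking `g` to be the indicator of `k` and dividing expectations by `m` gives `x (n + 1) = x n + (y n
- c * x n) / m`, where `y` is explicit or comes from a density already treated. This is the Euler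
scheme for `u' = v - c u`, and `limitU`, `α * limitL` and `α * limitE` solve the corresponding
equations. `euler_scheme_error` bounds the error by `B * n / m ^ 2`. The factor `n` matters: an item
probability is a density divided by `n / m`, so its error is still `B / m` when the load tends to
`0`.

Taking `g` to be a rising factorial makes it an eigenfunction of the same operators, so a discrete
Grönwall inequality bounds every moment uniformly (`density_rising_le`). Point probabilities
therefore decay faster than any power of `k`, uniformly in the table. Dominated convergence
(`tendsto_tsum`) then gives convergence in distribution and of moments, and also shows that the
limits have total mass one. -/

namespace CoalescedHashing

/-! ### Chains of links and their rank functions -/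

namespace Table

variable {m n : ℕ}

/-- Cell `c` lies on the chain that starts at cell `a`. -/
def Reach (T : Table m n) (a c : Fin m) : Prop := ∃ d, T.walk d a = some c

/-- The number of occupied cells on the chain that starts at cell `j`. -/
noncomputable def cost (T : Table m n) (j : Fin m) : ℕ :=
  Set.ncard {c | T.item c ≠ none ∧ ∃ d, T.walk d j = some c}

/-- The number of links from address `a` to the cell that stores item `i`. -/
noncomputable def disp (T : Table m n) (a : Fin m) (i : Fin n) : ℕ :=
  sInf {d | ∃ c, T.walk d a = some c ∧ T.item c = some i}

/-- The links form disjoint finite chains of occupied cells, and `ρ c` is the number of cells of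
the chain from `c` on. -/
structure IsRank (T : Table m n) (ρ : Fin m → ℕ) : Prop where
  zero_iff : ∀ c, ρ c = 0 ↔ T.item c = none
  of_none : ∀ c, T.link c = none → ρ c ≤ 1
  of_some : ∀ c e, T.link c = some e → ρ c = ρ e + 1 ∧ 0 < ρ e
  inj : ∀ c c' e, T.link c = some e → T.link c' = some e → c = c'

theorem reach_refl (T : Table m n) (a : Fin m) : T.Reach a a := ⟨0, rfl⟩

theorem reach_iff (T : Table m n) (a c : Fin m) :
    T.Reach a c ↔ a = c ∨ ∃ e, T.link a = some e ∧ T.Reach e c := by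
  constructor
  · rintro ⟨d, hd⟩
    cases d with
    | zero => left; simpa [walk] using hd
    | succ d =>
      right
      obtain ⟨e, he, h⟩ := Option.bind_eq_some_iff.1 hd
      exact ⟨e, he, d, h⟩
  · rintro (rfl | ⟨e, he, d, hd⟩)
    · exact T.reach_refl a
    · exact ⟨d + 1, by simp [walk, he, hd]⟩

theorem Reach.induction {T : Table m n} {c : Fin m} {P : Fin m → Prop} (base : P c)
    (step : ∀ a e, T.link a = some e → T.Reach e c → P e → P a) {a : Fin m} (h : T.Reach a c) :
    P a := by
  obtain ⟨d, hd⟩ := h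
  induction d generalizing a with
  | zero =>
    have : a = c := by simpa [walk] using hd
    exact this ▸ base
  | succ d ih =>
    obtain ⟨e, he, h⟩ := Option.bind_eq_some_iff.1 hd
    exact step a e he ⟨d, h⟩ (ih h)

theorem Reach.trans {T : Table m n} {a b c : Fin m} (h : T.Reach a b) (h' : T.Reach b c) :
    T.Reach a c :=
  h.induction (P := fun a => T.Reach a c) h' fun a e he _ hc =>
    (T.reach_iff a c).2 (.inr ⟨e, he, hc⟩)

theorem Reach.of_link {T : Table m n} {a b : Fin m} (h : T.link a = some b) : T.Reach a b :=
  (T.reach_iff a b).2 (.inr ⟨b, h, T.reach_refl b⟩)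

theorem Reach.eq_of_link_eq_none {T : Table m n} {a b c : Fin m} (hb : T.Reach a b)
    (hc : T.Reach a c) (hb' : T.link b = none) (hc' : T.link c = none) : b = c := by
  refine hb.induction (P := fun a => T.Reach a c → b = c) ?_ ?_ hc
  · intro h
    rcases (T.reach_iff b c).1 h with h | ⟨e, he, _⟩
    · exact h
    · simp [hb'] at he
  · intro a e he _ ih h
    rcases (T.reach_iff a c).1 h with rfl | ⟨e', he', h'⟩
    · simp [hc'] at he
    · obtain rfl : e = e' := by simpa [he] using he'
      exact ih h'

namespace IsRank

variable {T : Table m n} {ρ : Fin m → ℕ}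

theorem eq_add_of_walk (h : T.IsRank ρ) {d : ℕ} {a c : Fin m} (hd : T.walk d a = some c) :
    ρ a = ρ c + d := by
  induction d generalizing a with
  | zero =>
    have : a = c := by simpa [walk] using hd
    simp [this]
  | succ d ih =>
    obtain ⟨e, he, h'⟩ := Option.bind_eq_some_iff.1 hd
    have := ih h'
    have := (h.of_some a e he).1
    omega

theorem le_of_reach (h : T.IsRank ρ) {a c : Fin m} (hr : T.Reach a c) : ρ c ≤ ρ a := by
  obtain ⟨d, hd⟩ := hr
  have := h.eq_add_of_walk hd
  omega

theorem link_eq_none (h : T.IsRank ρ) {a : Fin m} (ha : ρ a = 0) : T.link a = none := by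
  cases hl : T.link a with
  | none => rfl
  | some e =>
    have := (h.of_some a e hl).1
    omega

theorem pos_of_reach (h : T.IsRank ρ) {a c : Fin m} (hr : T.Reach a c) (ha : 0 < ρ a) :
    0 < ρ c := by
  refine hr.induction (P := fun a => 0 < ρ a → 0 < ρ c) (fun h => h) ?_ ha
  intro a e he _ ih _
  exact ih (h.of_some a e he).2

theorem walk_injective (h : T.IsRank ρ) {d : ℕ} {a b c : Fin m} (ha : T.walk d a = some c)
    (hb : T.walk d b = some c) : a = b := by
  induction d generalizing a b with
  | zero =>
    have h1 : a = c := by simpa [walk] using ha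
    have h2 : b = c := by simpa [walk] using hb
    rw [h1, h2]
  | succ d ih =>
    obtain ⟨e, he, h1⟩ := Option.bind_eq_some_iff.1 ha
    obtain ⟨e', he', h2⟩ := Option.bind_eq_some_iff.1 hb
    obtain rfl := ih h1 h2
    exact h.inj a b e he he'

/-- Ranks drop by one along each link, so the start of a chain never recurs on its remainder and
each link accounts for one new cell. In particular a rank function is unique: to compute the costs
of a modified table it suffices to exhibit a rank function for it. -/
theorem cost_eq (h : T.IsRank ρ) (j : Fin m) : T.cost j = ρ j := by
  induction hk : ρ j generalizing j with
  | zero =>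
    have hj : T.item j = none := (h.zero_iff j).1 hk
    have : {c | T.item c ≠ none ∧ ∃ d, T.walk d j = some c} = ∅ := by
      ext c
      simp only [Set.mem_ofPred_eq, Set.mem_empty_iff_false, iff_false, not_and]
      intro hc hr
      rcases (T.reach_iff j c).1 hr with rfl | ⟨e, he, _⟩
      · exact hc hj
      · simp [h.link_eq_none hk] at he
    rw [cost, this, Set.ncard_empty]
  | succ k ih =>
    have hj : T.item j ≠ none := fun hj => by
      have := (h.zero_iff j).2 hj
      omega
    cases hl : T.link j with
    | none =>
      have : {c | T.item c ≠ none ∧ ∃ d, T.walk d j = some c} = {j} := by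
        ext c
        simp only [Set.mem_ofPred_eq, Set.mem_singleton_iff]
        constructor
        · rintro ⟨_, hr⟩
          rcases (T.reach_iff j c).1 hr with rfl | ⟨e, he, _⟩
          · rfl
          · simp [hl] at he
        · rintro rfl
          exact ⟨hj, T.reach_refl c⟩
      have h1 := h.of_none j hl
      rw [cost, this, Set.ncard_singleton]
      omega
    | some e =>
      have h1 := (h.of_some j e hl).1
      have : {c | T.item c ≠ none ∧ ∃ d, T.walk d j = some c} =
          Insert.insert j {c | T.item c ≠ none ∧ ∃ d, T.walk d e = some c} := by
        ext c
        simp only [Set.mem_ofPred_eq, Set.mem_insert_iff]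
        constructor
        · rintro ⟨hc, hr⟩
          rcases (T.reach_iff j c).1 hr with rfl | ⟨e', he, hr'⟩
          · exact .inl rfl
          · obtain rfl : e = e' := by simpa [hl] using he
            exact .inr ⟨hc, hr'⟩
        · rintro (rfl | ⟨hc, hr⟩)
          · exact ⟨hj, T.reach_refl c⟩
          · exact ⟨hc, (T.reach_iff j c).2 (.inr ⟨e, hl, hr⟩)⟩
      have h2 := ih e (by omega)
      rw [cost] at h2
      rw [cost, this, Set.ncard_insert_of_notMem, h2]
      rintro ⟨_, hr⟩
      have := h.le_of_reach hr
      omega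

theorem le (h : T.IsRank ρ) (j : Fin m) : ρ j ≤ m := by
  rw [← h.cost_eq j, cost]
  exact (Set.ncard_le_card _).trans (by simp)

/-- The length of a walk is the drop in rank, and an item occupies only one cell, so the infimum
runs over a singleton. Displacements thereby become differences of costs. -/
theorem disp_eq (h : T.IsRank ρ) (hinj : ∀ c c' i, T.item c = some i → T.item c' = some i → c = c')
    {a c : Fin m} {i : Fin n} (hc : T.item c = some i) (hr : T.Reach a c) :
    ρ a = ρ c + T.disp a i := by
  obtain ⟨d, hd⟩ := hr
  have : {d | ∃ c, T.walk d a = some c ∧ T.item c = some i} = {d} := by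
    ext d'
    simp only [Set.mem_ofPred_eq, Set.mem_singleton_iff]
    constructor
    · rintro ⟨c', hc', hi⟩
      obtain rfl := hinj c c' i hc hi
      have := h.eq_add_of_walk hd
      have := h.eq_add_of_walk hc'
      omega
    · rintro rfl
      exact ⟨c, hd, hc⟩
  rw [disp, this, csInf_singleton]
  exact h.eq_add_of_walk hd

theorem chainEnd_spec (h : T.IsRank ρ) (a : Fin m) :
    T.link (T.chainEnd a) = none ∧ T.Reach a (T.chainEnd a) := by
  -- A chain with at most `k + 1` cells is exhausted by `k` links; since ranks are at most `m`, the
  -- `m` iterations of `chainEnd` are enough.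
  have key : ∀ (k : ℕ) (a : Fin m), T.Reach a ((fun a => (T.link a).getD a)^[k] a) ∧
      (ρ a ≤ k + 1 → T.link ((fun a => (T.link a).getD a)^[k] a) = none) := by
    intro k
    induction k with
    | zero =>
      intro a
      refine ⟨T.reach_refl a, fun ha => ?_⟩
      cases hl : T.link a with
      | none => simpa using hl
      | some e =>
        have := h.of_some a e hl
        omega
    | succ k ih =>
      intro a
      rw [Function.iterate_succ_apply]
      cases hl : T.link a with
      | none =>
        simp only [Option.getD_none]
        have hfix : (fun a => (T.link a).getD a)^[k] a = a :=
          Function.iterate_fixed (by simp [hl]) k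
        rw [hfix]
        exact ⟨T.reach_refl a, fun _ => hl⟩
      | some e =>
        simp only [Option.getD_some]
        have := h.of_some a e hl
        exact ⟨(Reach.of_link hl).trans (ih e).1, fun ha => (ih e).2 (by omega)⟩
  exact ⟨(key m a).2 (by have := h.le a; omega), (key m a).1⟩

theorem reach_chainEnd_iff (h : T.IsRank ρ) (a b : Fin m) :
    T.Reach b (T.chainEnd a) ↔ T.chainEnd b = T.chainEnd a := by
  constructor
  · intro hr
    exact (h.chainEnd_spec b).2.eq_of_link_eq_none hr (h.chainEnd_spec b).1 (h.chainEnd_spec a).1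
  · intro he
    rw [← he]
    exact (h.chainEnd_spec b).2

theorem chainEnd_eq_of_reach (h : T.IsRank ρ) {a b : Fin m} (hr : T.Reach a b) :
    T.chainEnd a = T.chainEnd b :=
  (h.reach_chainEnd_iff b a).1 (hr.trans (h.chainEnd_spec b).2)

theorem rank_chainEnd (h : T.IsRank ρ) {a : Fin m} (ha : 0 < ρ a) : ρ (T.chainEnd a) = 1 := by
  have h1 := h.of_none _ (h.chainEnd_spec a).1
  have h2 := h.pos_of_reach (h.chainEnd_spec a).2 ha
  omega

/-- Both cells lie at the same distance from the common end, and no cell has two predecessors, so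
walking back from the end is deterministic. -/
theorem eq_of_chainEnd_eq (h : T.IsRank ρ) {a b : Fin m} (he : T.chainEnd a = T.chainEnd b)
    (hρ : ρ a = ρ b) : a = b := by
  obtain ⟨d, hd⟩ := (h.chainEnd_spec a).2
  obtain ⟨d', hd'⟩ := (h.chainEnd_spec b).2
  have h1 := h.eq_add_of_walk hd
  have h2 := h.eq_add_of_walk hd'
  rw [he] at h1 hd
  obtain rfl : d = d' := by omega
  exact h.walk_injective hd hd'

-- The cell `e` takes over the successor of `c`, hence its rank, and lengthens precisely the chains
-- through `c`. No link pointed to `e`, because it had rank `0`. The insertion point is arbitrary,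
-- so both policies are covered.
open Classical in
theorem storeAfter (h : T.IsRank ρ) (i : Fin n) {c e : Fin m} (hc : 0 < ρ c) (he : ρ e = 0) :
    (T.storeAfter i c e).IsRank
      (fun j => if j = e then ρ c else ρ j + if T.Reach j c then 1 else 0) := by
  have hce : c ≠ e := by rintro rfl; omega
  have hnot : ∀ j, ρ j = 0 → ¬ T.Reach j c := by
    intro j hj hr
    have := h.le_of_reach hr
    omega
  have hlc : (T.storeAfter i c e).link c = some e := by simp [Table.storeAfter]
  have hle : (T.storeAfter i c e).link e = T.link c := by
    simp [Table.storeAfter, Function.update_of_ne hce.symm]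
  have hlo : ∀ j, j ≠ c → j ≠ e → (T.storeAfter i c e).link j = T.link j := by
    intro j h1 h2
    simp [Table.storeAfter, Function.update_of_ne h1, Function.update_of_ne h2]
  have hne : ∀ j x, T.link j = some x → x ≠ e := by
    rintro j x hx rfl
    have := (h.of_some j x hx).2
    omega
  constructor
  · intro j
    by_cases hj : j = e
    · subst hj
      simp [Table.storeAfter, hc.ne']
    · simp only [hj, if_false, Table.storeAfter, Function.update_of_ne hj, ← h.zero_iff j]
      constructor
      · intro h'; omega
      · intro h'; simp [h', hnot j h']
  · intro j hl
    by_cases hjc : j = c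
    · subst hjc; simp [hlc] at hl
    by_cases hj : j = e
    · subst hj
      rw [hle] at hl
      simpa using h.of_none c hl
    · rw [hlo j hjc hj] at hl
      have : ¬ T.Reach j c := by
        intro hr
        rcases (T.reach_iff j c).1 hr with h' | ⟨x, hx, _⟩
        · exact hjc h'
        · simp [hl] at hx
      simpa [hj, this] using h.of_none j hl
  · intro j x hl
    by_cases hjc : j = c
    · subst hjc
      obtain rfl : e = x := by simpa [hlc] using hl
      simp [hce, T.reach_refl, hc]
    by_cases hj : j = e
    · subst hj
      rw [hle] at hl
      have h1 := h.of_some c x hl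
      have h2 : ¬ T.Reach x c := fun hr => by
        have := h.le_of_reach hr
        omega
      simpa [hne c x hl, h2] using h1
    · rw [hlo j hjc hj] at hl
      have h1 := h.of_some j x hl
      have h2 : T.Reach j c ↔ T.Reach x c := by
        rw [T.reach_iff j c]
        simp [hjc, hl]
      simp only [hj, hne j x hl, if_false, h2]
      omega
  · intro j j' x hl hl'
    by_cases hjc : j = c
    · subst hjc
      obtain rfl : e = x := by simpa [hlc] using hl
      by_contra hne'
      by_cases hj' : j' = e
      · subst hj'
        rw [hle] at hl'
        exact hne _ _ hl' rfl
      · rw [hlo j' (Ne.symm hne') hj'] at hl'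
        exact hne _ _ hl' rfl
    by_cases hjc' : j' = c
    · subst hjc'
      obtain rfl : e = x := by simpa [hlc] using hl'
      by_cases hj' : j = e
      · subst hj'
        rw [hle] at hl
        exact (hne _ _ hl rfl).elim
      · rw [hlo j hjc hj'] at hl
        exact (hne _ _ hl rfl).elim
    by_cases hj : j = e <;> by_cases hj' : j' = e
    · rw [hj, hj']
    · rw [hj, hle] at hl
      rw [hlo j' hjc' hj'] at hl'
      exact (hjc' (h.inj _ _ _ hl' hl)).elim
    · rw [hj', hle] at hl'
      rw [hlo j hjc hj] at hl
      exact (hjc (h.inj _ _ _ hl hl')).elim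
    · rw [hlo j hjc hj] at hl
      rw [hlo j' hjc' hj'] at hl'
      exact h.inj _ _ _ hl hl'

/-- A link from `c` to `x` is replaced by the detour through `e`; all other links survive, since `e`
had none to lose. -/
theorem reach_storeAfter (h : T.IsRank ρ) (i : Fin n) {c e : Fin m} (hc : 0 < ρ c) (he : ρ e = 0)
    {a b : Fin m} (hr : T.Reach a b) : (T.storeAfter i c e).Reach a b := by
  have hce : c ≠ e := by rintro rfl; omega
  refine hr.induction (P := fun a => (T.storeAfter i c e).Reach a b) (reach_refl _ b) ?_
  intro a x hx _ ih
  by_cases hac : a = c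
  · subst hac
    refine (Reach.of_link (b := e) ?_).trans ((Reach.of_link (b := x) ?_).trans ih)
    · simp [Table.storeAfter]
    · simpa [Table.storeAfter, Function.update_of_ne hce.symm] using hx
  · have hae : a ≠ e := by
      rintro rfl
      simp [h.link_eq_none he] at hx
    refine (Reach.of_link (b := x) ?_).trans ih
    simpa [Table.storeAfter, Function.update_of_ne hac, Function.update_of_ne hae] using hx

theorem update_item (h : T.IsRank ρ) (i : Fin n) {a : Fin m} (ha : ρ a = 0) :
    IsRank { T with item := Function.update T.item a (some i) } (Function.update ρ a 1) := by
  have hne : ∀ j x, T.link j = some x → x ≠ a := by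
    rintro j x hx rfl
    have := (h.of_some j x hx).2
    omega
  constructor
  · intro j
    by_cases hj : j = a
    · subst hj; simp
    · simp [Function.update_of_ne hj, h.zero_iff]
  · intro j hl
    by_cases hj : j = a
    · subst hj; simp
    · simpa [Function.update_of_ne hj] using h.of_none j hl
  · intro j x hl
    have hj : j ≠ a := by
      rintro rfl
      have := h.link_eq_none ha
      simp_all
    rw [Function.update_of_ne hj, Function.update_of_ne (hne j x hl)]
    exact h.of_some j x hl
  · exact h.inj

end IsRank

/-! ### Adding one more item -/

/-- The same table, with room for one more item. -/
def lift (T : Table m n) : Table m (n + 1) where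
  item := fun c => (T.item c).map Fin.castSucc
  link := T.link

theorem lift_walk (T : Table m n) (d : ℕ) (c : Fin m) : T.lift.walk d c = T.walk d c := by
  induction d generalizing c with
  | zero => rfl
  | succ d ih =>
    simp only [walk, lift]
    congr 1
    funext x
    exact ih x

theorem lift_reach (T : Table m n) (a c : Fin m) : T.lift.Reach a c ↔ T.Reach a c := by
  simp [Reach, lift_walk]

theorem lift_item_eq_none (T : Table m n) (c : Fin m) :
    T.lift.item c = none ↔ T.item c = none := by
  simp [lift]

theorem lift_item_eq_some (T : Table m n) (c : Fin m) (i : Fin n) :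
    T.lift.item c = some i.castSucc ↔ T.item c = some i := by
  simp [lift]

theorem lift_freeCell (T : Table m n) : T.lift.freeCell = T.freeCell := by
  unfold freeCell
  congr 1
  ext c
  simp [lift_item_eq_none]

theorem IsRank.lift {T : Table m n} {ρ : Fin m → ℕ} (h : T.IsRank ρ) : T.lift.IsRank ρ :=
  ⟨fun c => by rw [h.zero_iff, lift_item_eq_none], h.of_none, h.of_some, h.inj⟩

theorem lift_insert (Ξ : Policy) (T : Table m n) (i : Fin n) (a : Fin m) :
    (T.insert Ξ i a).lift = T.lift.insert Ξ i.castSucc a := by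
  have hupd : ∀ e : Fin m, (fun c => (Function.update T.item e (some i) c).map Fin.castSucc) =
      Function.update T.lift.item e (some i.castSucc) := by
    intro e
    funext c
    by_cases hc : c = e
    · subst hc; simp
    · simp [Function.update_of_ne hc, Table.lift]
  unfold Table.insert
  by_cases ha : T.item a = none
  · rw [if_pos ha, if_pos ((T.lift_item_eq_none a).2 ha), Table.lift, hupd]
    rfl
  · rw [if_neg ha, if_neg (by rwa [lift_item_eq_none]), lift_freeCell]
    cases T.freeCell with
    | none => rfl
    | some e =>
      cases Ξ with
      | late =>
        simp only [Table.lift, Table.storeAfter, hupd]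
        rfl
      | early => simp only [Table.lift, Table.storeAfter, hupd]

theorem item_of_freeCell_eq_some {T : Table m n} {e : Fin m} (h : T.freeCell = some e) :
    T.item e = none := by
  have := Finset.mem_of_max (s := Finset.univ.filter fun c => T.item c = none) h
  simpa using this

theorem item_of_freeCell_eq_none {T : Table m n} (h : T.freeCell = none) (c : Fin m) :
    T.item c ≠ none := by
  have := (Finset.max_eq_bot (s := Finset.univ.filter fun c => T.item c = none)).1 h
  intro hc
  have hmem : c ∈ Finset.univ.filter fun c => T.item c = none := by simpa using hc
  simp [this] at hmem

end Table

/-- The placement of an item does not depend on labels, so enlarging the label type commutes with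
insertion. This makes the construction recursive in `n`, with the last address free to be averaged
over. -/
theorem buildTable_snoc (Ξ : Policy) {m n : ℕ} (h : Fin n → Fin m) (a : Fin m) :
    buildTable Ξ (Fin.snoc h a : Fin (n + 1) → Fin m) =
      (buildTable Ξ h).lift.insert Ξ (Fin.last n) a := by
  have key : ∀ (l : List (Fin n)) (T : Table m n),
      (l.map Fin.castSucc).foldl
        (fun T i => T.insert Ξ i ((Fin.snoc h a : Fin (n + 1) → Fin m) i)) T.lift =
      (l.foldl (fun T i => T.insert Ξ i (h i)) T).lift := by
    intro l
    induction l with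
    | nil => intro T; rfl
    | cons i l ih =>
      intro T
      rw [List.map_cons, List.foldl_cons, List.foldl_cons, ← ih, Table.lift_insert]
      simp
  rw [buildTable, List.finRange_succ_last, List.foldl_append, List.foldl_cons, List.foldl_nil,
    buildTable, ← key]
  simp only [Fin.snoc_last]
  rfl

/-! ### Valid tables and the effect of a single insertion -/

namespace Table

variable {m n : ℕ}

/-- The table `T` is a possible result of inserting items with hash addresses `h`. -/
structure Valid (T : Table m n) (h : Fin n → Fin m) : Prop where
  rank : T.IsRank T.cost
  loc : ∀ i, ∃ c, T.item c = some i ∧ T.Reach (h i) c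
  inj : ∀ c c' i, T.item c = some i → T.item c' = some i → c = c'

theorem IsRank.eq_cost {T : Table m n} {ρ : Fin m → ℕ} (h : T.IsRank ρ) : ρ = T.cost :=
  funext fun j => (h.cost_eq j).symm

theorem valid_empty (h : Fin 0 → Fin m) : (empty m 0).Valid h := by
  have hr : (empty m 0).IsRank fun _ => 0 :=
    ⟨fun c => by simp [empty], fun c _ => by simp, fun c e hl => by simp [empty] at hl,
      fun c c' e hl => by simp [empty] at hl⟩
  exact ⟨hr.eq_cost ▸ hr, fun i => i.elim0, fun c c' i => i.elim0⟩

theorem lift_item_ne_last (T : Table m n) (c : Fin m) : T.lift.item c ≠ some (Fin.last n) := by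
  simp only [lift, ne_eq, Option.map_eq_some_iff, not_exists, not_and]
  intro i _
  exact (Fin.castSucc_lt_last i).ne

namespace Valid

variable {T : Table m n} {h : Fin n → Fin m}

theorem cost_eq_zero_iff (hT : T.Valid h) (c : Fin m) : T.cost c = 0 ↔ T.item c = none :=
  hT.rank.zero_iff c

theorem card_occupied (hT : T.Valid h) :
    (Finset.univ.filter fun c => T.cost c ≠ 0).card = n := by
  choose f hf using hT.loc
  have himg : Finset.univ.image f = Finset.univ.filter fun c => T.cost c ≠ 0 := by
    ext c
    simp only [Finset.mem_image, Finset.mem_univ, true_and, Finset.mem_filter, ne_eq,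
      hT.cost_eq_zero_iff]
    constructor
    · rintro ⟨i, rfl⟩
      simp [(hf i).1]
    · intro hc
      obtain ⟨i, hi⟩ := Option.ne_none_iff_exists'.1 hc
      exact ⟨i, hT.inj _ _ i (hf i).1 hi⟩
  rw [← himg, Finset.card_image_of_injective, Finset.card_univ, Fintype.card_fin]
  intro i i' hii
  have h1 := (hf i).1
  rw [hii, (hf i').1] at h1
  exact (Option.some.inj h1).symm

theorem card_empty (hT : T.Valid h) :
    (Finset.univ.filter fun c => T.cost c = 0).card = (m : ℝ) - n := by
  have h1 := Finset.card_filter_add_card_filter_not (s := (Finset.univ : Finset (Fin m)))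
    (fun c => T.cost c = 0)
  rw [hT.card_occupied, Finset.card_univ, Fintype.card_fin] at h1
  have h2 : (m : ℝ) = (Finset.univ.filter fun c => T.cost c = 0).card + n := by
    exact_mod_cast h1.symm
  linarith

theorem lift_inj (hT : T.Valid h) (c c' : Fin m) (i : Fin (n + 1)) (hc : T.lift.item c = some i)
    (hc' : T.lift.item c' = some i) : c = c' := by
  induction i using Fin.lastCases with
  | last => exact (T.lift_item_ne_last c hc).elim
  | cast i =>
    exact hT.inj c c' i ((T.lift_item_eq_some c i).1 hc) ((T.lift_item_eq_some c' i).1 hc')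

theorem update_inj (hT : T.Valid h) (e : Fin m) (c c' : Fin m) (i : Fin (n + 1))
    (hc : Function.update T.lift.item e (some (Fin.last n)) c = some i)
    (hc' : Function.update T.lift.item e (some (Fin.last n)) c' = some i) : c = c' := by
  by_cases h1 : c = e <;> by_cases h2 : c' = e
  · rw [h1, h2]
  · subst h1
    rw [Function.update_of_ne h2] at hc'
    obtain rfl : Fin.last n = i := by simpa using hc
    exact (T.lift_item_ne_last c' hc').elim
  · subst h2
    rw [Function.update_of_ne h1] at hc
    obtain rfl : Fin.last n = i := by simpa using hc'
    exact (T.lift_item_ne_last c hc).elim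
  · rw [Function.update_of_ne h1] at hc
    rw [Function.update_of_ne h2] at hc'
    exact hT.lift_inj c c' i hc hc'

theorem item_update_of_some (hT : T.Valid h) {e c : Fin m} {i : Fin n} (he : T.cost e = 0)
    (hc : T.item c = some i) :
    Function.update T.lift.item e (some (Fin.last n)) c = some i.castSucc := by
  have : c ≠ e := by
    rintro rfl
    rw [hT.cost_eq_zero_iff] at he
    simp [he] at hc
  rw [Function.update_of_ne this, lift_item_eq_some, hc]

section Store

variable {a c e : Fin m} (hT : T.Valid h) (hac : T.Reach a c) (hc : 0 < T.cost c)
  (he : T.cost e = 0)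

include hT hc he

open Classical in
theorem cost_storeAfter (j : Fin m) : (T.lift.storeAfter (Fin.last n) c e).cost j =
    if j = e then T.cost c else T.cost j + if T.Reach j c then 1 else 0 := by
  rw [(hT.rank.lift.storeAfter (Fin.last n) hc he).cost_eq]
  simp only [lift_reach]

omit he in
theorem not_reach_of_cost_eq_zero {j : Fin m} (hj : T.cost j = 0) : ¬ T.Reach j c := fun hr => by
  have := hT.rank.le_of_reach hr
  omega

include hac in
theorem storeAfter :
    (T.lift.storeAfter (Fin.last n) c e).Valid (Fin.snoc h a : Fin (n + 1) → Fin m) := by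
  classical
  have hr := hT.rank.lift.storeAfter (Fin.last n) hc he
  refine ⟨hr.eq_cost ▸ hr, ?_, hT.update_inj e⟩
  intro i
  induction i using Fin.lastCases with
  | last =>
    refine ⟨e, by simp [Table.storeAfter], ?_⟩
    rw [Fin.snoc_last]
    refine (hT.rank.lift.reach_storeAfter _ hc he ((T.lift_reach a c).2 hac)).trans
      (Reach.of_link ?_)
    simp [Table.storeAfter]
  | cast i =>
    obtain ⟨x, hx, hr⟩ := hT.loc i
    refine ⟨x, hT.item_update_of_some he hx, ?_⟩
    rw [Fin.snoc_castSucc]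
    exact hT.rank.lift.reach_storeAfter _ hc he ((T.lift_reach _ x).2 hr)

-- The address gains one because it reaches `c`, while `e` has the old cost of `c`. For `c = a` the
-- result is `1`; for the chain end, whose cost is `1`, it is the old cost of `a`.
include hac in
theorem disp_storeAfter_last :
    (T.lift.storeAfter (Fin.last n) c e).disp a (Fin.last n) = T.cost a + 1 - T.cost c := by
  classical
  have hV := hT.storeAfter hac hc he
  obtain ⟨x, hx, hr⟩ := hV.loc (Fin.last n)
  rw [Fin.snoc_last] at hr
  have hxe : x = e := hV.inj x e _ hx (by simp [Table.storeAfter])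
  subst hxe
  have h1 := hV.rank.disp_eq hV.inj hx hr
  rw [hT.cost_storeAfter hc he, hT.cost_storeAfter hc he, if_pos rfl, if_pos hac, if_neg] at h1
  · omega
  · rintro rfl
    exact hT.not_reach_of_cost_eq_zero hc he hac

-- The new cell comes between the address and the item exactly when the insertion point lies on the
-- path to the item's cell, strictly before it.
include hac in
open Classical in
theorem disp_storeAfter_castSucc {x : Fin m} {i : Fin n} (hx : T.item x = some i)
    (hr : T.Reach (h i) x) :
    (T.lift.storeAfter (Fin.last n) c e).disp (h i) i.castSucc =
      T.disp (h i) i + if T.Reach (h i) c ∧ ¬ T.Reach x c then 1 else 0 := by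
  have hV := hT.storeAfter hac hc he
  have hr' := hT.rank.lift.reach_storeAfter (Fin.last n) hc he ((T.lift_reach (h i) x).2 hr)
  have h1 := hV.rank.disp_eq hV.inj (hT.item_update_of_some he hx) hr'
  have h2 := hT.rank.disp_eq hT.inj hx hr
  have hx0 : T.cost x ≠ 0 := by
    rw [ne_eq, hT.cost_eq_zero_iff]
    simp [hx]
  have hne1 : x ≠ e := by rintro rfl; omega
  have hne2 : h i ≠ e := by
    intro hie
    rw [hie] at h2
    omega
  rw [hT.cost_storeAfter hc he, hT.cost_storeAfter hc he, if_neg hne1, if_neg hne2] at h1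
  have himp : T.Reach x c → T.Reach (h i) c := hr.trans
  by_cases c1 : T.Reach x c
  · simp only [c1, himp c1, if_true, not_true, and_false, if_false] at h1 ⊢
    omega
  · by_cases c2 : T.Reach (h i) c
    · simp only [c1, c2, if_true, not_false_eq_true, and_true, if_false] at h1 ⊢
      omega
    · simp only [c1, c2, not_false_eq_true, and_true, if_false] at h1 ⊢
      omega

open Classical in
theorem sum_storeAfter (g : ℕ → ℝ) : ∑ j, g ((T.lift.storeAfter (Fin.last n) c e).cost j) =
    ∑ j, g (T.cost j) + ∑ j, (if T.Reach j c then g (T.cost j + 1) - g (T.cost j) else 0) +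
      (g (T.cost c) - g 0) := by
  have h1 : ∀ j, g ((T.lift.storeAfter (Fin.last n) c e).cost j) =
      g (T.cost j) + (if T.Reach j c then g (T.cost j + 1) - g (T.cost j) else 0) +
        if j = e then g (T.cost c) - g 0 else 0 := by
    intro j
    rw [hT.cost_storeAfter hc he]
    by_cases hj : j = e
    · subst hj
      simp [hT.not_reach_of_cost_eq_zero hc he, he]
    · by_cases hr : T.Reach j c <;> simp [hj, hr]
  simp only [h1, Finset.sum_add_distrib, Finset.sum_ite_eq', Finset.mem_univ, if_true]

end Store

section Fresh

variable {a : Fin m} (hT : T.Valid h) (ha : T.cost a = 0)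

include hT ha

theorem insert_of_empty (Ξ : Policy) : T.lift.insert Ξ (Fin.last n) a =
    { T.lift with item := Function.update T.lift.item a (some (Fin.last n)) } := by
  rw [Table.insert, if_pos]
  rwa [lift_item_eq_none, ← hT.cost_eq_zero_iff]

theorem cost_insert_of_empty (Ξ : Policy) :
    (T.lift.insert Ξ (Fin.last n) a).cost = Function.update T.cost a 1 := by
  rw [hT.insert_of_empty ha]
  exact (hT.rank.lift.update_item (Fin.last n) ha).eq_cost.symm

theorem reach_insert_of_empty (Ξ : Policy) {x y : Fin m} :
    (T.lift.insert Ξ (Fin.last n) a).Reach x y ↔ T.Reach x y := by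
  rw [hT.insert_of_empty ha, ← T.lift_reach]
  have : ∀ d x, walk { T.lift with
      item := Function.update T.lift.item a (some (Fin.last n)) } d x = T.lift.walk d x := by
    intro d
    induction d with
    | zero => intro x; rfl
    | succ d ih =>
      intro x
      simp only [walk]
      congr 1
      funext y
      exact ih y
  simp only [Reach, this]

theorem insert_valid_of_empty (Ξ : Policy) :
    (T.lift.insert Ξ (Fin.last n) a).Valid (Fin.snoc h a : Fin (n + 1) → Fin m) := by
  have hr := hT.rank.lift.update_item (Fin.last n) ha
  refine ⟨?_, ?_, ?_⟩
  · rw [hT.cost_insert_of_empty ha, hT.insert_of_empty ha]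
    exact hr
  · intro i
    simp only [hT.reach_insert_of_empty ha]
    rw [hT.insert_of_empty ha]
    induction i using Fin.lastCases with
    | last => exact ⟨a, by simp, by simpa using T.reach_refl a⟩
    | cast i =>
      obtain ⟨x, hx, hr⟩ := hT.loc i
      exact ⟨x, hT.item_update_of_some ha hx, by simpa using hr⟩
  · rw [hT.insert_of_empty ha]
    exact hT.update_inj a

theorem disp_insert_of_empty_last (Ξ : Policy) :
    (T.lift.insert Ξ (Fin.last n) a).disp a (Fin.last n) = 0 := by
  have hV := hT.insert_valid_of_empty ha Ξ
  have := hV.rank.disp_eq hV.inj (c := a) (a := a) (i := Fin.last n)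
    (by rw [hT.insert_of_empty ha]; simp) (reach_refl _ a)
  omega

theorem disp_insert_of_empty_castSucc (Ξ : Policy) (i : Fin n) :
    (T.lift.insert Ξ (Fin.last n) a).disp (h i) i.castSucc = T.disp (h i) i := by
  have hV := hT.insert_valid_of_empty ha Ξ
  obtain ⟨x, hx, hr⟩ := hT.loc i
  have h1 := hV.rank.disp_eq hV.inj (c := x) (a := h i) (i := i.castSucc)
    (by rw [hT.insert_of_empty ha]; exact hT.item_update_of_some ha hx)
    ((hT.reach_insert_of_empty ha Ξ).2 hr)
  have h2 := hT.rank.disp_eq hT.inj hx hr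
  have hx0 : T.cost x ≠ 0 := by
    rw [ne_eq, hT.cost_eq_zero_iff]
    simp [hx]
  rw [hT.cost_insert_of_empty ha, Function.update_of_ne, Function.update_of_ne] at h1
  · omega
  · rintro rfl; omega
  · intro hia
    rw [hia] at h2
    omega

theorem sum_insert_of_empty (Ξ : Policy) (g : ℕ → ℝ) :
    ∑ j, g ((T.lift.insert Ξ (Fin.last n) a).cost j) = ∑ j, g (T.cost j) + (g 1 - g 0) := by
  have h1 : ∀ j, g ((T.lift.insert Ξ (Fin.last n) a).cost j) =
      g (T.cost j) + if j = a then g 1 - g 0 else 0 := by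
    intro j
    rw [hT.cost_insert_of_empty ha]
    by_cases hj : j = a
    · subst hj; simp [ha]
    · simp [hj]
  simp only [h1, Finset.sum_add_distrib, Finset.sum_ite_eq', Finset.mem_univ, if_true]

end Fresh

/-- As `n` items occupy only `n` of the `m` cells, a free cell exists. Only its emptiness is
recorded: its index has no influence on the averages. -/
theorem exists_storeAfter_of_occupied (hT : T.Valid h) (hn : n < m) {a : Fin m}
    (ha : T.cost a ≠ 0) : ∃ e, T.cost e = 0 ∧
      T.lift.insert .early (Fin.last n) a = T.lift.storeAfter (Fin.last n) a e ∧
      T.lift.insert .late (Fin.last n) a = T.lift.storeAfter (Fin.last n) (T.chainEnd a) e := by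
  have ha' : ¬ T.lift.item a = none := by rwa [lift_item_eq_none, ← hT.cost_eq_zero_iff]
  simp only [Table.insert, if_neg ha']
  cases hf : T.lift.freeCell with
  | none =>
    exfalso
    have h1 := hT.card_occupied
    have h2 : (Finset.univ.filter fun c => T.cost c ≠ 0) = Finset.univ := by
      refine Finset.filter_true_of_mem fun c _ => ?_
      rw [ne_eq, hT.cost_eq_zero_iff, ← lift_item_eq_none]
      exact item_of_freeCell_eq_none hf c
    rw [h2, Finset.card_univ, Fintype.card_fin] at h1
    omega
  | some e =>
    refine ⟨e, ?_, rfl, rfl⟩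
    rw [hT.cost_eq_zero_iff, ← lift_item_eq_none]
    exact item_of_freeCell_eq_some hf

theorem insert_valid (hT : T.Valid h) (hn : n < m) (Ξ : Policy) (a : Fin m) :
    (T.lift.insert Ξ (Fin.last n) a).Valid (Fin.snoc h a : Fin (n + 1) → Fin m) := by
  by_cases ha : T.cost a = 0
  · exact hT.insert_valid_of_empty ha Ξ
  · obtain ⟨e, he, h1, h2⟩ := hT.exists_storeAfter_of_occupied hn ha
    cases Ξ with
    | early =>
      rw [h1]
      exact hT.storeAfter (T.reach_refl a) (Nat.pos_of_ne_zero ha) he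
    | late =>
      rw [h2]
      refine hT.storeAfter (hT.rank.chainEnd_spec a).2 ?_ he
      rw [hT.rank.rank_chainEnd (Nat.pos_of_ne_zero ha)]
      exact one_pos

open Classical in
theorem card_reach (hT : T.Valid h) (j : Fin m) :
    (Finset.univ.filter fun a => T.cost a ≠ 0 ∧ T.Reach j a).card = T.cost j := by
  rw [cost, ← Set.ncard_coe_finset]
  congr 1
  ext c
  simp [hT.cost_eq_zero_iff, Reach]

theorem sum_if_empty (hT : T.Valid h) (x : ℝ) :
    ∑ a, (if T.cost a = 0 then x else 0) = (m - n) * x := by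
  rw [← Finset.sum_filter, Finset.sum_const, nsmul_eq_mul, hT.card_empty]

/-- Exchange the sums: the cell `j` is raised once for each occupied cell on its chain, that is,
`T.cost j` times. The remaining `g (T.cost j) - g 0` comes from the cell filled when `j` is the
address. -/
theorem sum_early_occupied (hT : T.Valid h) (g : ℕ → ℝ) :
    open Classical in
    ∑ a, (if T.cost a = 0 then 0 else
      ∑ j, (if T.Reach j a then g (T.cost j + 1) - g (T.cost j) else 0) + (g (T.cost a) - g 0)) =
    ∑ j, (T.cost j * g (T.cost j + 1) - (T.cost j - 1) * g (T.cost j) - g 0) := by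
  classical
  have h1 : ∀ a, (if T.cost a = 0 then 0 else
      ∑ j, (if T.Reach j a then g (T.cost j + 1) - g (T.cost j) else 0) + (g (T.cost a) - g 0)) =
      ∑ j, (if T.cost a ≠ 0 ∧ T.Reach j a then g (T.cost j + 1) - g (T.cost j) else 0) +
        (g (T.cost a) - g 0) := by
    intro a
    by_cases ha : T.cost a = 0 <;> simp [ha]
  simp only [h1, Finset.sum_add_distrib]
  rw [Finset.sum_comm, ← Finset.sum_add_distrib]
  refine Finset.sum_congr rfl fun j _ => ?_
  rw [← Finset.sum_filter, Finset.sum_const, nsmul_eq_mul, hT.card_reach]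
  ring

end Valid

/-! ### Sums over whole chains and the averaged insertion identities -/

theorem _root_.Finset.eq_image_succ_range_card (S : Finset ℕ) (h0 : 0 ∉ S)
    (h : ∀ k, k ≠ 0 → k + 1 ∈ S → k ∈ S) : S = (Finset.range S.card).image Nat.succ := by
  have hdown : ∀ k l, k ≠ 0 → k + l ∈ S → k ∈ S := by
    intro k l hk
    induction l with
    | zero => exact fun h => h
    | succ l ih => exact fun hl => ih (h (k + l) (by omega) hl)
  have hS : S = (Finset.range (S.sup id)).image Nat.succ := by
    ext k
    simp only [Finset.mem_image, Finset.mem_range]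
    constructor
    · intro hk
      have hk0 : k ≠ 0 := by rintro rfl; exact h0 hk
      have : k ≤ S.sup id := Finset.le_sup (f := id) hk
      exact ⟨k - 1, by omega, by omega⟩
    · rintro ⟨l, hl, rfl⟩
      have hne : S.Nonempty := by
        by_contra hne
        rw [Finset.not_nonempty_iff_eq_empty] at hne
        simp [hne] at hl
      obtain ⟨x, hx, hxs⟩ := Finset.exists_mem_eq_sup S hne id
      refine hdown _ (x - (l + 1)) (by omega) ?_
      simp only [id] at hxs
      rw [Nat.add_sub_cancel' (by omega)]
      exact hx
  have hcard : S.card = S.sup id := by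
    conv_lhs => rw [hS]
    rw [Finset.card_image_of_injective _ Nat.succ_injective, Finset.card_range]
  rw [hcard]
  exact hS

/-- Occupied cells with a common end have distinct positive ranks, and following a link passes from
rank `k + 1` to rank `k`. The ranks are therefore exactly `1, …, ℓ`. -/
theorem IsRank.sum_chain {T : Table m n} {ρ : Fin m → ℕ} (h : T.IsRank ρ) (x : Fin m)
    (F : ℕ → ℝ) :
    ∑ j ∈ (Finset.univ.filter fun j => ρ j ≠ 0) with T.chainEnd j = x, F (ρ j) =
      ∑ k ∈ Finset.range
        ((Finset.univ.filter fun j => ρ j ≠ 0).filter fun j => T.chainEnd j = x).card,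
        F (k + 1) := by
  set O := (Finset.univ.filter fun j => ρ j ≠ 0).filter fun j => T.chainEnd j = x with hO
  have hinj : Set.InjOn ρ O := by
    intro a ha b hb hab
    have ha' : a ∈ O := ha
    have hb' : b ∈ O := hb
    rw [hO, Finset.mem_filter] at ha' hb'
    exact h.eq_of_chainEnd_eq (ha'.2.trans hb'.2.symm) hab
  have himg : O.image ρ = (Finset.range (O.image ρ).card).image Nat.succ := by
    refine Finset.eq_image_succ_range_card _ ?_ ?_
    · simp only [hO, Finset.mem_image, not_exists, not_and]
      intro a ha ha0
      simp [ha0] at ha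
    · intro k hk hmem
      obtain ⟨a, ha, hak⟩ := Finset.mem_image.1 hmem
      rw [hO, Finset.mem_filter] at ha
      cases hl : T.link a with
      | none =>
        have := h.of_none a hl
        omega
      | some e =>
        have h1 := h.of_some a e hl
        refine Finset.mem_image.2 ⟨e, ?_, by omega⟩
        rw [hO, Finset.mem_filter, Finset.mem_filter]
        refine ⟨⟨Finset.mem_univ e, by omega⟩, ?_⟩
        rw [← h.chainEnd_eq_of_reach (Reach.of_link hl)]
        exact ha.2
  rw [Finset.card_image_of_injOn hinj] at himg
  rw [← Finset.sum_image (f := F) (g := ρ) hinj, himg,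
    Finset.sum_image Nat.succ_injective.injOn]

namespace Valid

variable {T : Table m n} {h : Fin n → Fin m}

/-- Group the cells by chain end. In a chain of length `ℓ` each of the `ℓ` addresses raises all
costs `1, …, ℓ` by one and adds a cell of cost `1`, contributing `ℓ * (g (ℓ + 1) - g 0)` in all. The
right side telescopes to the same value, though the two sides differ cell by cell. -/
theorem sum_late_occupied (hT : T.Valid h) (g : ℕ → ℝ) :
    ∑ a, (if T.cost a = 0 then 0 else
      ∑ j, (if T.chainEnd j = T.chainEnd a then g (T.cost j + 1) - g (T.cost j) else 0) +
        (g 1 - g 0)) =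
    ∑ j, (T.cost j * g (T.cost j + 1) - (T.cost j - 1) * g (T.cost j) - g 0) := by
  set O := Finset.univ.filter fun j => T.cost j ≠ 0 with hO
  have hL : ∀ a, (if T.cost a = 0 then 0 else
      ∑ j, (if T.chainEnd j = T.chainEnd a then g (T.cost j + 1) - g (T.cost j) else 0) +
        (g 1 - g 0)) = if T.cost a ≠ 0 then
      ∑ j ∈ O with T.chainEnd j = T.chainEnd a, (g (T.cost j + 1) - g (T.cost j)) +
        (g 1 - g 0) else 0 := by
    intro a
    by_cases ha : T.cost a = 0
    · simp [ha]
    · simp only [ha, if_false, ne_eq, not_false_eq_true, if_true]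
      rw [← Finset.sum_filter]
      congr 2
      ext j
      simp only [hO, Finset.mem_filter, Finset.mem_univ, true_and]
      -- A cell sharing its end with an occupied cell is occupied: that end has cost `1`, and costs
      -- do not increase along a chain.
      refine ⟨fun hj => ⟨fun hj0 => ?_, hj⟩, fun hj => hj.2⟩
      have h1 := hT.rank.le_of_reach ((hT.rank.reach_chainEnd_iff a j).2 hj)
      rw [hT.rank.rank_chainEnd (Nat.pos_of_ne_zero ha)] at h1
      omega
  have hR : ∀ j, (T.cost j * g (T.cost j + 1) - (T.cost j - 1) * g (T.cost j) - g 0) =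
      if T.cost j ≠ 0 then
        (T.cost j * g (T.cost j + 1) - (T.cost j - 1) * g (T.cost j) - g 0) else 0 := by
    intro j
    by_cases hj : T.cost j = 0 <;> simp [hj]
  rw [Finset.sum_congr rfl fun a _ => hL a, Finset.sum_congr rfl fun a _ => hR a,
    ← Finset.sum_filter, ← Finset.sum_filter, ← hO, ← Finset.sum_fiberwise O T.chainEnd,
    ← Finset.sum_fiberwise O T.chainEnd]
  refine Finset.sum_congr rfl fun x _ => ?_
  have h1 := hT.rank.sum_chain x fun c => g (c + 1) - g c
  have h2 := hT.rank.sum_chain x fun c => c * g (c + 1) - (c - 1) * g c - g 0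
  rw [← hO] at h1 h2
  rw [h2]
  have h3 : ∀ a ∈ O.filter fun j => T.chainEnd j = x,
      ∑ j ∈ O with T.chainEnd j = T.chainEnd a, (g (T.cost j + 1) - g (T.cost j)) +
        (g 1 - g 0) =
      ∑ k ∈ Finset.range (O.filter fun j => T.chainEnd j = x).card, (g (k + 1 + 1) - g (k + 1)) +
        (g 1 - g 0) := by
    intro a ha
    rw [(Finset.mem_filter.1 ha).2, h1]
  rw [Finset.sum_congr rfl h3, Finset.sum_const, nsmul_eq_mul]
  set ℓ := (O.filter fun j => T.chainEnd j = x).card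
  rw [Finset.sum_range_sub (fun k => g (k + 1)), Finset.sum_sub_distrib, Finset.sum_const,
    Finset.card_range, nsmul_eq_mul]
  have h4 : ∑ k ∈ Finset.range ℓ,
      (((k + 1 : ℕ) : ℝ) * g (k + 1 + 1) - (((k + 1 : ℕ) : ℝ) - 1) * g (k + 1)) =
      ℓ * g (ℓ + 1) := by
    have := Finset.sum_range_sub (fun k : ℕ => (k : ℝ) * g (k + 1)) ℓ
    simp only [Nat.cast_zero, zero_mul, sub_zero] at this
    rw [← this]
    refine Finset.sum_congr rfl fun k _ => ?_
    push_cast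
    ring
  rw [h4]
  ring

theorem sum_cost_insert (hT : T.Valid h) (hn : n < m) (Ξ : Policy) (g : ℕ → ℝ) :
    ∑ a, ∑ j, g ((T.lift.insert Ξ (Fin.last n) a).cost j) =
      m * ∑ j, g (T.cost j) + (m - n) * (g 1 - g 0) +
        ∑ j, (T.cost j * g (T.cost j + 1) - (T.cost j - 1) * g (T.cost j) - g 0) := by
  classical
  have key : ∀ a, ∑ j, g ((T.lift.insert Ξ (Fin.last n) a).cost j) =
      ∑ j, g (T.cost j) + (if T.cost a = 0 then g 1 - g 0 else 0) +
        match Ξ with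
        | .early => if T.cost a = 0 then 0 else
            ∑ j, (if T.Reach j a then g (T.cost j + 1) - g (T.cost j) else 0) +
              (g (T.cost a) - g 0)
        | .late => if T.cost a = 0 then 0 else
            ∑ j, (if T.chainEnd j = T.chainEnd a then g (T.cost j + 1) - g (T.cost j) else 0) +
              (g 1 - g 0) := by
    intro a
    by_cases ha : T.cost a = 0
    · rw [hT.sum_insert_of_empty ha]
      cases Ξ <;> simp [ha]
    · obtain ⟨e, he, h1, h2⟩ := hT.exists_storeAfter_of_occupied hn ha
      have hpos := Nat.pos_of_ne_zero ha
      cases Ξ with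
      | early =>
        rw [h1, hT.sum_storeAfter hpos he]
        simp only [ha, if_false]
        ring
      | late =>
        have hend := hT.rank.rank_chainEnd hpos
        rw [h2, hT.sum_storeAfter (by rw [hend]; exact one_pos) he, hend]
        simp only [ha, if_false, hT.rank.reach_chainEnd_iff]
        ring
  rw [Finset.sum_congr rfl fun a _ => key a, Finset.sum_add_distrib, Finset.sum_add_distrib,
    Finset.sum_const, Finset.card_univ, Fintype.card_fin, nsmul_eq_mul, hT.sum_if_empty]
  congr 1
  cases Ξ with
  | early => exact hT.sum_early_occupied g
  | late => exact hT.sum_late_occupied g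

/-- An address and the cell of its item share their chain end, so a cell appended there never
separates them. Only the new item contributes, with the cost of an unsuccessful search from its
address. -/
theorem sum_disp_insert_late (hT : T.Valid h) (hn : n < m) (g : ℕ → ℝ) :
    ∑ a, ∑ i, g ((T.lift.insert .late (Fin.last n) a).disp
        ((Fin.snoc h a : Fin (n + 1) → Fin m) i) i) =
      m * ∑ i, g (T.disp (h i) i) + ∑ a, g (T.cost a) := by
  classical
  have key : ∀ a, ∑ i, g ((T.lift.insert .late (Fin.last n) a).disp
        ((Fin.snoc h a : Fin (n + 1) → Fin m) i) i) =
      ∑ i, g (T.disp (h i) i) + g (T.cost a) := by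
    intro a
    rw [Fin.sum_univ_castSucc, Fin.snoc_last]
    simp only [Fin.snoc_castSucc]
    by_cases ha : T.cost a = 0
    · simp only [hT.disp_insert_of_empty_castSucc ha, hT.disp_insert_of_empty_last ha, ha]
    · obtain ⟨e, he, h1, h2⟩ := hT.exists_storeAfter_of_occupied hn ha
      have hpos := Nat.pos_of_ne_zero ha
      have hend := hT.rank.rank_chainEnd hpos
      have hc : 0 < T.cost (T.chainEnd a) := by rw [hend]; exact one_pos
      have hac := (hT.rank.chainEnd_spec a).2
      rw [h2, hT.disp_storeAfter_last hac hc he, hend, Nat.add_sub_cancel]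
      congr 1
      refine Finset.sum_congr rfl fun i _ => ?_
      obtain ⟨x, hx, hr⟩ := hT.loc i
      rw [hT.disp_storeAfter_castSucc hac hc he hx hr, if_neg, add_zero]
      rw [hT.rank.reach_chainEnd_iff, hT.rank.reach_chainEnd_iff, hT.rank.chainEnd_eq_of_reach hr]
      tauto
  rw [Finset.sum_congr rfl fun a _ => key a, Finset.sum_add_distrib,
    Finset.sum_const, Finset.card_univ, Fintype.card_fin, nsmul_eq_mul]

/-- An item is pushed back exactly when the address is one of the cells strictly before it on its
path, and their number is its displacement. The new item gets displacement `0` at the `m - n` empty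
addresses and `1` at the others. -/
theorem sum_disp_insert_early (hT : T.Valid h) (hn : n < m) (g : ℕ → ℝ) :
    ∑ a, ∑ i, g ((T.lift.insert .early (Fin.last n) a).disp
        ((Fin.snoc h a : Fin (n + 1) → Fin m) i) i) =
      m * ∑ i, g (T.disp (h i) i) +
        ∑ i, T.disp (h i) i * (g (T.disp (h i) i + 1) - g (T.disp (h i) i)) +
        ((m - n) * g 0 + n * g 1) := by
  classical
  choose x hx hr using hT.loc
  have key : ∀ a, ∑ i, g ((T.lift.insert .early (Fin.last n) a).disp
        ((Fin.snoc h a : Fin (n + 1) → Fin m) i) i) =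
      ∑ i, g (T.disp (h i) i) +
        -- Occupancy is repeated in both clauses so that each describes a set counted by
        -- `card_reach`; the displacement appears as the difference of the two costs.
        ∑ i, (if (T.cost a ≠ 0 ∧ T.Reach (h i) a) ∧ ¬ (T.cost a ≠ 0 ∧ T.Reach (x i) a) then
          g (T.disp (h i) i + 1) - g (T.disp (h i) i) else 0) +
        ((if T.cost a = 0 then g 0 else 0) + if T.cost a ≠ 0 then g 1 else 0) := by
    intro a
    rw [Fin.sum_univ_castSucc, Fin.snoc_last]
    simp only [Fin.snoc_castSucc]
    by_cases ha : T.cost a = 0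
    · simp [hT.disp_insert_of_empty_castSucc ha, hT.disp_insert_of_empty_last ha, ha]
    · obtain ⟨e, he, h1, h2⟩ := hT.exists_storeAfter_of_occupied hn ha
      have hpos := Nat.pos_of_ne_zero ha
      have hac := T.reach_refl a
      rw [h1, hT.disp_storeAfter_last hac hpos he, Nat.add_sub_cancel_left,
        ← Finset.sum_add_distrib]
      simp only [ha, ne_eq, not_false_eq_true, true_and, if_false, if_true, zero_add]
      congr 1
      refine Finset.sum_congr rfl fun i _ => ?_
      rw [hT.disp_storeAfter_castSucc hac hpos he (hx i) (hr i)]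
      split_ifs <;> simp
  rw [Finset.sum_congr rfl fun a _ => key a, Finset.sum_add_distrib, Finset.sum_add_distrib,
    Finset.sum_const, Finset.card_univ, Fintype.card_fin, nsmul_eq_mul, Finset.sum_add_distrib,
    hT.sum_if_empty, ← Finset.sum_filter (fun a => T.cost a ≠ 0), Finset.sum_const,
    hT.card_occupied, nsmul_eq_mul, Finset.sum_comm]
  congr 2
  refine Finset.sum_congr rfl fun i _ => ?_
  rw [← Finset.sum_filter, Finset.sum_const, nsmul_eq_mul]
  congr 2
  rw [Finset.filter_and_not, Finset.card_sdiff_of_subset, hT.card_reach, hT.card_reach]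
  · have := hT.rank.disp_eq hT.inj (hx i) (hr i)
    omega
  · intro a
    simp only [Finset.mem_filter, Finset.mem_univ, true_and]
    exact fun h' => ⟨h'.1, (hr i).trans h'.2⟩

end Valid

end Table

theorem buildTable_valid (Ξ : Policy) {m n : ℕ} (hn : n ≤ m) (h : Fin n → Fin m) :
    (buildTable Ξ h).Valid h := by
  induction n with
  | zero => exact Table.valid_empty h
  | succ n ih =>
    have := (ih (by omega) (Fin.init h)).insert_valid (by omega) Ξ (h (Fin.last n))
    rwa [← buildTable_snoc, Fin.snoc_init_self] at this

/-! ### Euler scheme and discrete Grönwall inequality -/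

section Euler

theorem contDiff_one_of_hasDerivAt {u v : ℝ → ℝ} {c : ℝ}
    (hu : ∀ t, HasDerivAt u (v t - c * u t) t) (hv : Continuous v) : ContDiff ℝ 1 u := by
  have hd : Differentiable ℝ u := fun t => (hu t).differentiableAt
  rw [contDiff_one_iff_deriv]
  refine ⟨hd, ?_⟩
  have : deriv u = fun t => v t - c * u t := funext fun t => (hu t).deriv
  rw [this]
  have := hd.continuous
  fun_prop

theorem exists_abs_sub_le_of_contDiff {w : ℝ → ℝ} (hw : ContDiff ℝ 1 w) :
    ∃ K, 0 ≤ K ∧ ∀ s ∈ Set.Icc (0 : ℝ) 1, ∀ t ∈ Set.Icc (0 : ℝ) 1, |w s - w t| ≤ K * |s - t| := by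
  have hc : Continuous (deriv w) := (contDiff_one_iff_deriv.1 hw).2
  obtain ⟨K, hK⟩ := isCompact_Icc.exists_bound_of_continuousOn (s := Set.Icc (0 : ℝ) 1)
    hc.continuousOn
  refine ⟨K, (norm_nonneg _).trans (hK 0 (by simp)), fun s hs t ht => ?_⟩
  exact (convex_Icc (0 : ℝ) 1).norm_image_sub_le_of_norm_deriv_le
    (fun x _ => (contDiff_one_iff_deriv.1 hw).1 x) hK ht hs

/-- The error of the Euler scheme with `m` steps for the equation `u' = v - c u` on `[0, 1]`. -/
theorem euler_scheme_error {u v : ℝ → ℝ} {c : ℝ} (hc : 0 ≤ c)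
    (hu : ∀ t, HasDerivAt u (v t - c * u t) t) (hv : ContDiff ℝ 1 v) {A : ℝ} (hA : 0 ≤ A) :
    ∃ B, 0 ≤ B ∧ ∀ (m : ℕ) (x y : ℕ → ℝ), 0 < m → c ≤ m → x 0 = u 0 →
      (∀ n < m, x (n + 1) = x n + 1 / m * (y n - c * x n)) →
      (∀ n < m, |y n - v (n / m)| ≤ A / m) →
      ∀ n ≤ m, |x n - u (n / m)| ≤ B * n / m ^ 2 := by
  have hu1 := contDiff_one_of_hasDerivAt hu hv.continuous
  obtain ⟨K, hK0, hK⟩ := exists_abs_sub_le_of_contDiff (w := fun t => v t - c * u t)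
    (hv.sub (contDiff_const.mul hu1))
  refine ⟨A + K, by positivity, fun m x y hm hcm h0 hx hy n => ?_⟩
  have hm' : (0 : ℝ) < m := by exact_mod_cast hm
  induction n with
  | zero => intro _; simp [h0]
  | succ n ih =>
    intro hn
    have hnm : n < m := by omega
    have ih := ih hnm.le
    have hnr : ((n : ℝ) + 1) / m ≤ 1 := by
      rw [div_le_one hm']
      exact_mod_cast hn
    have hlt : (n : ℝ) / m < (n + 1) / m := by gcongr; linarith
    have hn0 : (0 : ℝ) ≤ n / m := by positivity
    have hstep : ((n : ℝ) + 1) / m - n / m = 1 / m := by ring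
    obtain ⟨s, hs, hs'⟩ := exists_hasDerivAt_eq_slope u (fun t => v t - c * u t) hlt
      (hu1.continuous.continuousOn) (fun t _ => hu t)
    rw [hstep] at hs'
    have hslope : u ((n + 1) / m) - u (n / m) = 1 / m * (v s - c * u s) := by
      rw [hs']
      field_simp
    have hw := hK s ⟨by linarith [hs.1], by linarith [hs.2]⟩ (n / m) ⟨hn0, by linarith⟩
    have hsn : |s - n / m| ≤ 1 / m := by
      rw [abs_of_pos (by linarith [hs.1])]
      linarith [hs.2]
    have hw' : |(v s - c * u s) - (v (n / m) - c * u (n / m))| ≤ K / m := by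
      refine hw.trans ?_
      calc K * |s - n / m| ≤ K * (1 / m) := by gcongr
        _ = K / m := by ring
    -- The new error is the old one damped by `1 - c / m`, plus the input error, minus the local
    -- error from the mean value theorem. The assumption `c ≤ m` puts the damping factor in `[0,
    -- 1]`, so each step adds at most `(A + K) / m ^ 2`.
    have hid : x (n + 1) - u ((n + 1) / m) = (1 - c / m) * (x n - u (n / m)) +
        1 / m * (y n - v (n / m)) - 1 / m * ((v s - c * u s) - (v (n / m) - c * u (n / m))) := by
      rw [hx n hnm]
      have : u ((n + 1) / m) = u (n / m) + 1 / m * (v s - c * u s) := by linarith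
      rw [this]
      ring
    have hcm1 : c / m ≤ 1 := (div_le_one hm').2 hcm
    have hcm0 : 0 ≤ c / m := by positivity
    have e1 : |(1 - c / m) * (x n - u (n / m))| ≤ (A + K) * n / m ^ 2 := by
      rw [abs_mul, abs_of_nonneg (by linarith)]
      refine (mul_le_of_le_one_left (abs_nonneg _) (by linarith)).trans ih
    have e2 : |1 / (m : ℝ) * (y n - v (n / m))| ≤ A / m ^ 2 := by
      rw [abs_mul, abs_of_pos (by positivity)]
      calc 1 / (m : ℝ) * |y n - v (n / m)| ≤ 1 / m * (A / m) := by gcongr; exact hy n hnm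
        _ = A / m ^ 2 := by ring
    have e3 : |1 / (m : ℝ) * ((v s - c * u s) - (v (n / m) - c * u (n / m)))| ≤ K / m ^ 2 := by
      rw [abs_mul, abs_of_pos (by positivity)]
      calc 1 / (m : ℝ) * |(v s - c * u s) - (v (n / m) - c * u (n / m))| ≤ 1 / m * (K / m) := by
            gcongr
        _ = K / m ^ 2 := by ring
    push_cast
    rw [hid]
    calc _ ≤ |(1 - c / m) * (x n - u (n / m))| + |1 / (m : ℝ) * (y n - v (n / m))| +
          |1 / (m : ℝ) * ((v s - c * u s) - (v (n / m) - c * u (n / m)))| :=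
          (abs_sub _ _).trans (by gcongr; exact abs_add_le _ _)
      _ ≤ (A + K) * n / m ^ 2 + A / m ^ 2 + K / m ^ 2 := by gcongr
      _ = (A + K) * (n + 1) / m ^ 2 := by ring

theorem abs_const_mul_sub_le_div {a b c A : ℝ} (hc : 0 ≤ c) {m n : ℕ} (hm : 0 < m) (hn : n ≤ m)
    (hA : 0 ≤ A) (h : |a - b| ≤ A * n / m ^ 2) : |c * a - c * b| ≤ c * A / m := by
  have hm' : (0 : ℝ) < m := by exact_mod_cast hm
  have hn' : (n : ℝ) ≤ m := by exact_mod_cast hn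
  rw [← mul_sub, abs_mul, abs_of_nonneg hc]
  calc c * |a - b| ≤ c * (A * n / m ^ 2) := by gcongr
    _ ≤ c * (A * m / m ^ 2) := by gcongr
    _ = c * A / m := by field_simp

/-- A discrete Grönwall inequality. -/
theorem le_of_succ_le {C D : ℝ} (hC : 0 ≤ C) (hD : 0 ≤ D) {m : ℕ} (hm : 0 < m) {x : ℕ → ℝ}
    (h0 : x 0 ≤ 0) (hx : ∀ n < m, x (n + 1) ≤ (1 + C / m) * x n + D / m) {n : ℕ} (hn : n ≤ m) :
    x n ≤ D * Real.exp C * (n / m) := by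
  have hm' : (0 : ℝ) < m := by exact_mod_cast hm
  have hr : 1 ≤ 1 + C / m := by
    have : 0 ≤ C / m := by positivity
    linarith
  -- The factor `n` is kept so that the final bound is proportional to `n / m`, as loads tending to
  -- `0` require.
  have key : ∀ n ≤ m, x n ≤ D / m * n * (1 + C / m) ^ n := by
    intro n
    induction n with
    | zero => intro _; simpa using h0
    | succ n ih =>
      intro hn
      have h1 : 1 ≤ (1 + C / m) ^ (n + 1) := one_le_pow₀ hr
      calc x (n + 1) ≤ (1 + C / m) * x n + D / m := hx n (by omega)
        _ ≤ (1 + C / m) * (D / m * n * (1 + C / m) ^ n) + D / m * (1 + C / m) ^ (n + 1) := by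
          refine add_le_add ?_ (le_mul_of_one_le_right (by positivity) h1)
          exact mul_le_mul_of_nonneg_left (ih (by omega)) (by linarith)
        _ = D / m * (n + 1 : ℕ) * (1 + C / m) ^ (n + 1) := by push_cast; ring
  have hexp : (1 + C / m) ^ n ≤ Real.exp C := by
    calc (1 + C / m) ^ n ≤ (1 + C / m) ^ m := pow_le_pow_right₀ hr hn
      _ ≤ Real.exp (C / m) ^ m := by
        gcongr
        linarith [Real.add_one_le_exp (C / m)]
      _ = Real.exp C := by
        rw [← Real.exp_nat_mul]
        congr 1
        field_simp
  calc x n ≤ D / m * n * (1 + C / m) ^ n := key n hn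
    _ ≤ D / m * n * Real.exp C := by gcongr
    _ = D * Real.exp C * (n / m) := by ring

end Euler

/-! ### Differential equations of the limit functions -/

section LimitFunctions

theorem hasDerivAt_integral {f : ℝ → ℝ} (hf : Continuous f) (x : ℝ) :
    HasDerivAt (fun x => ∫ t in (0 : ℝ)..x, f t) (f x) x :=
  (hf.integral_hasStrictDerivAt 0 x).hasDerivAt

/-- Expanding the product moves the parameter out of the integrand; the boundary terms cancel
because `x - t` vanishes at `t = x`. -/
theorem hasDerivAt_integral_sub_mul {f : ℝ → ℝ} (hf : Continuous f) (x : ℝ) :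
    HasDerivAt (fun x => ∫ t in (0 : ℝ)..x, (x - t) * f t) (∫ t in (0 : ℝ)..x, f t) x := by
  have h1 : (fun x => ∫ t in (0 : ℝ)..x, (x - t) * f t) =
      fun x => x * (∫ t in (0 : ℝ)..x, f t) - ∫ t in (0 : ℝ)..x, t * f t := by
    funext x
    rw [← intervalIntegral.integral_const_mul, ← intervalIntegral.integral_sub]
    · congr 1
      funext t
      ring
    · exact (hf.const_smul x).intervalIntegrable 0 x
    · exact (continuous_id.mul hf).intervalIntegrable 0 x
  rw [h1]
  have h2 := (((hasDerivAt_id' x).mul (hasDerivAt_integral hf x)).sub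
    (hasDerivAt_integral (f := fun t => t * f t) (continuous_id.mul hf) x))
  refine h2.congr_deriv ?_
  ring

theorem hasDerivAt_integral_sub_sq_mul {f : ℝ → ℝ} (hf : Continuous f) (x : ℝ) :
    HasDerivAt (fun x => ∫ t in (0 : ℝ)..x, (x - t) ^ 2 / 2 * f t)
      (∫ t in (0 : ℝ)..x, (x - t) * f t) x := by
  have hf2 : Continuous fun t => t ^ 2 / 2 * f t := by fun_prop
  have h1 : (fun x => ∫ t in (0 : ℝ)..x, (x - t) ^ 2 / 2 * f t) =
      fun x => x * (∫ t in (0 : ℝ)..x, (x - t) * f t) - x ^ 2 / 2 * (∫ t in (0 : ℝ)..x, f t) +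
        ∫ t in (0 : ℝ)..x, t ^ 2 / 2 * f t := by
    funext x
    rw [← intervalIntegral.integral_const_mul, ← intervalIntegral.integral_const_mul,
      ← intervalIntegral.integral_sub, ← intervalIntegral.integral_add]
    · congr 1
      funext t
      ring
    all_goals
      refine Continuous.intervalIntegrable ?_ 0 x
      fun_prop
  rw [h1]
  have h2 := (((hasDerivAt_id' x).mul (hasDerivAt_integral_sub_mul hf x)).sub
    ((((hasDerivAt_id' x).pow 2).div_const 2).mul (hasDerivAt_integral hf x))).add
    (hasDerivAt_integral hf2 x)
  refine h2.congr_deriv ?_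
  simp only [Nat.cast_ofNat, Nat.reduceSub, pow_one, Pi.pow_apply]
  ring

theorem hasDerivAt_one_sub_exp_neg_pow (k : ℕ) (t : ℝ) :
    HasDerivAt (fun t => (1 - Real.exp (-t)) ^ (k + 1))
      ((k + 1) * (1 - Real.exp (-t)) ^ k * Real.exp (-t)) t := by
  have h1 : HasDerivAt (fun t => 1 - Real.exp (-t)) (Real.exp (-t)) t := by
    simpa using ((hasDerivAt_neg t).exp).const_sub 1
  exact (h1.pow (k + 1)).congr_deriv (by simp)

theorem limitU_succ_eq (α : ℝ) (k : ℕ) : limitU α (k + 1) =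
    (∫ t in (0 : ℝ)..α, (1 - Real.exp (-t)) ^ k) -
      ∫ t in (0 : ℝ)..α, (α - t) * (1 - Real.exp (-t)) ^ k := by
  rw [limitU, ← intervalIntegral.integral_sub]
  · congr 1
    funext t
    ring
  · exact Continuous.intervalIntegrable (by fun_prop) 0 α
  · exact Continuous.intervalIntegrable (by fun_prop) 0 α

theorem hasDerivAt_limitU_one (α : ℝ) : HasDerivAt (fun α => limitU α 1) (1 - α) α := by
  have h : (fun α => limitU α 1) = fun α => (∫ t in (0 : ℝ)..α, (1 - Real.exp (-t)) ^ 0) -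
      ∫ t in (0 : ℝ)..α, (α - t) * (1 - Real.exp (-t)) ^ 0 := funext fun α => limitU_succ_eq α 0
  rw [h]
  refine ((hasDerivAt_integral (by fun_prop) α).sub
    (hasDerivAt_integral_sub_mul (by fun_prop) α)).congr_deriv ?_
  simp

/-- Integrating the derivative of `(1 - α + t) * (1 - exp (-t)) ^ (k + 1)` turns the boundary value
minus the integral into one integral. Writing `exp (-t) = 1 - (1 - exp (-t))` there splits it into
the two neighbouring values of `limitU`. -/
theorem hasDerivAt_limitU_succ (k : ℕ) (α : ℝ) : HasDerivAt (fun α => limitU α (k + 2))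
    ((k + 1) * limitU α (k + 1) - (k + 1) * limitU α (k + 2)) α := by
  have h : (fun α => limitU α (k + 2)) =
      fun α => (∫ t in (0 : ℝ)..α, (1 - Real.exp (-t)) ^ (k + 1)) -
        ∫ t in (0 : ℝ)..α, (α - t) * (1 - Real.exp (-t)) ^ (k + 1) :=
    funext fun α => limitU_succ_eq α (k + 1)
  rw [h]
  refine ((hasDerivAt_integral (by fun_prop) α).sub
    (hasDerivAt_integral_sub_mul (by fun_prop) α)).congr_deriv ?_
  have hparts := intervalIntegral.integral_eq_sub_of_hasDerivAt (a := 0) (b := α)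
    (f := fun t => (1 - α + t) * (1 - Real.exp (-t)) ^ (k + 1))
    (f' := fun t => (1 - Real.exp (-t)) ^ (k + 1) +
      (1 - α + t) * ((k + 1) * (1 - Real.exp (-t)) ^ k * Real.exp (-t)))
    (fun t _ => by
      have := ((hasDerivAt_id' t).const_add (1 - α)).mul (hasDerivAt_one_sub_exp_neg_pow k t)
      exact this.congr_deriv (by simp))
    (Continuous.intervalIntegrable (by fun_prop) 0 α)
  rw [intervalIntegral.integral_add (Continuous.intervalIntegrable (by fun_prop) 0 α)
    (Continuous.intervalIntegrable (by fun_prop) 0 α)] at hparts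
  have hdiff : (k + 1) * limitU α (k + 1) - (k + 1) * limitU α (k + 2) =
      ∫ t in (0 : ℝ)..α, (1 - α + t) * ((k + 1) * (1 - Real.exp (-t)) ^ k * Real.exp (-t)) := by
    rw [limitU, limitU, ← intervalIntegral.integral_const_mul,
      ← intervalIntegral.integral_const_mul, ← intervalIntegral.integral_sub]
    · congr 1
      funext t
      ring
    · exact Continuous.intervalIntegrable (by fun_prop) 0 α
    · exact Continuous.intervalIntegrable (by fun_prop) 0 α
  rw [hdiff]
  simp only [neg_zero, Real.exp_zero, sub_self, ne_eq, Nat.add_eq_zero_iff, one_ne_zero, and_false,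
    not_false_eq_true, zero_pow, mul_zero, sub_zero, sub_add_cancel, one_mul] at hparts
  linarith

theorem contDiff_limitU (k : ℕ) : ContDiff ℝ 1 fun α => limitU α k := by
  match k with
  | 0 => simpa [limitU] using contDiff_const.sub contDiff_id
  | 1 =>
    refine contDiff_one_of_hasDerivAt (v := fun α => 1 - α) (c := 0) (fun t => ?_) (by fun_prop)
    simpa using hasDerivAt_limitU_one t
  | k + 2 =>
    refine contDiff_one_of_hasDerivAt (v := fun α => (k + 1) * limitU α (k + 1)) (c := k + 1)
      (hasDerivAt_limitU_succ k) ?_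
    exact continuous_const.mul (contDiff_limitU (k + 1)).continuous

theorem mul_limitL_succ (α : ℝ) (k : ℕ) : α * limitL α (k + 1) =
    (∫ t in (0 : ℝ)..α, (α - t) * (1 - Real.exp (-t)) ^ k) -
      ∫ t in (0 : ℝ)..α, (α - t) ^ 2 / 2 * (1 - Real.exp (-t)) ^ k := by
  rw [← intervalIntegral.integral_sub (Continuous.intervalIntegrable (by fun_prop) 0 α)
    (Continuous.intervalIntegrable (by fun_prop) 0 α), limitL]
  by_cases hα : α = 0
  · subst hα; simp
  · rw [if_neg hα, ← mul_assoc, mul_one_div_cancel hα, one_mul]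
    congr 1
    funext t
    ring

/-- The weight `α - t - (α - t) ^ 2 / 2` vanishes at `α = t` and has `α`-derivative `1 - α + t`, the
weight in `limitU`. The factor `α` removes the case distinction at `0`. -/
theorem hasDerivAt_mul_limitL (k : ℕ) (α : ℝ) :
    HasDerivAt (fun α => α * limitL α k) (limitU α k) α := by
  cases k with
  | zero =>
    simp only [limitL, limitU]
    refine ((hasDerivAt_id' α).mul (((hasDerivAt_id' α).div_const 2).const_sub 1)).congr_deriv ?_
    ring
  | succ k =>
    simp only [mul_limitL_succ]
    rw [limitU_succ_eq]
    exact (hasDerivAt_integral_sub_mul (by fun_prop) α).sub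
      (hasDerivAt_integral_sub_sq_mul (by fun_prop) α)

theorem mul_limitE_succ (α : ℝ) (k : ℕ) : α * limitE α (k + 1) =
    ∫ t in (0 : ℝ)..α, (α - t) * (Real.exp (-t) * (1 - Real.exp (-t)) ^ k) := by
  rw [limitE]
  by_cases hα : α = 0
  · subst hα; simp
  · rw [if_neg hα, ← mul_assoc, mul_one_div_cancel hα, one_mul]
    congr 1
    funext t
    ring

/-- Integration by parts against `α - t`; both boundary terms vanish. -/
theorem succ_mul_mul_limitE_succ (α : ℝ) (k : ℕ) : (k + 1) * (α * limitE α (k + 1)) =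
    ∫ t in (0 : ℝ)..α, (1 - Real.exp (-t)) ^ (k + 1) := by
  have hparts := intervalIntegral.integral_eq_sub_of_hasDerivAt (a := 0) (b := α)
    (f := fun t => (α - t) * (1 - Real.exp (-t)) ^ (k + 1))
    (f' := fun t => -(1 - Real.exp (-t)) ^ (k + 1) +
      (α - t) * ((k + 1) * (1 - Real.exp (-t)) ^ k * Real.exp (-t)))
    (fun t _ => by
      have := ((hasDerivAt_id' t).const_sub α).mul (hasDerivAt_one_sub_exp_neg_pow k t)
      exact this.congr_deriv (by simp))
    (Continuous.intervalIntegrable (by fun_prop) 0 α)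
  rw [intervalIntegral.integral_add (Continuous.intervalIntegrable (by fun_prop) 0 α)
    (Continuous.intervalIntegrable (by fun_prop) 0 α), intervalIntegral.integral_neg] at hparts
  have h1 : (k + 1) * (α * limitE α (k + 1)) =
      ∫ t in (0 : ℝ)..α, (α - t) * ((k + 1) * (1 - Real.exp (-t)) ^ k * Real.exp (-t)) := by
    rw [mul_limitE_succ, ← intervalIntegral.integral_const_mul]
    congr 1
    funext t
    ring
  rw [h1]
  simp only [neg_zero, Real.exp_zero, sub_self, ne_eq, Nat.add_eq_zero_iff, one_ne_zero, and_false,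
    not_false_eq_true, zero_pow, mul_zero, sub_zero, zero_mul] at hparts
  linarith

theorem hasDerivAt_mul_limitE_succ_integral (k : ℕ) (α : ℝ) :
    HasDerivAt (fun α => α * limitE α (k + 1))
      ((∫ t in (0 : ℝ)..α, (1 - Real.exp (-t)) ^ k) -
        (k + 1) * (α * limitE α (k + 1))) α := by
  rw [succ_mul_mul_limitE_succ, ← intervalIntegral.integral_sub
    (Continuous.intervalIntegrable (by fun_prop) 0 α)
    (Continuous.intervalIntegrable (by fun_prop) 0 α)]
  simp only [mul_limitE_succ]
  refine (hasDerivAt_integral_sub_mul (by fun_prop) α).congr_deriv ?_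
  congr 1
  funext t
  ring

theorem hasDerivAt_mul_limitE_zero (α : ℝ) :
    HasDerivAt (fun α => α * limitE α 0) (1 - α) α := by
  simp only [limitE]
  refine ((hasDerivAt_id' α).mul (((hasDerivAt_id' α).div_const 2).const_sub 1)).congr_deriv ?_
  ring

theorem hasDerivAt_mul_limitE_one (α : ℝ) :
    HasDerivAt (fun α => α * limitE α 1) (α - 1 * (α * limitE α 1)) α := by
  refine (hasDerivAt_mul_limitE_succ_integral 0 α).congr_deriv ?_
  simp

theorem hasDerivAt_mul_limitE_succ (k : ℕ) (α : ℝ) :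
    HasDerivAt (fun α => α * limitE α (k + 2))
      ((k + 1) * (α * limitE α (k + 1)) - (k + 2) * (α * limitE α (k + 2))) α := by
  refine (hasDerivAt_mul_limitE_succ_integral (k + 1) α).congr_deriv ?_
  rw [succ_mul_mul_limitE_succ α k]
  push_cast
  ring

theorem contDiff_mul_limitE (k : ℕ) : ContDiff ℝ 1 fun α => α * limitE α k := by
  match k with
  | 0 =>
    refine contDiff_one_of_hasDerivAt (v := fun α => 1 - α) (c := 0) (fun t => ?_) (by fun_prop)
    simpa using hasDerivAt_mul_limitE_zero t
  | 1 => exact contDiff_one_of_hasDerivAt hasDerivAt_mul_limitE_one continuous_id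
  | k + 2 =>
    refine contDiff_one_of_hasDerivAt (v := fun α => (k + 1) * (α * limitE α (k + 1)))
      (c := k + 2) (hasDerivAt_mul_limitE_succ k) ?_
    exact continuous_const.mul (contDiff_mul_limitE (k + 1)).continuous

end LimitFunctions

/-! ### Exact recursions for expected densities -/

/-- The sum of `g` over all values of the quantity in a table. -/
noncomputable def Quantity.total {m n : ℕ} (h : Fin n → Fin m) (g : ℕ → ℝ) : Quantity → ℝ
  | .item Ξ => ∑ i, g (itemDisplacement Ξ h i)
  | .unsuccessful Ξ => ∑ j, g (unsuccessfulCost Ξ h j)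

/-- The expectation of `q.total`, divided by the number of cells. -/
noncomputable def Quantity.density (q : Quantity) (m n : ℕ) (g : ℕ → ℝ) : ℝ :=
  (∑ h : Fin n → Fin m, q.total h g) / (m : ℝ) ^ (n + 1)

theorem sum_snoc {m n : ℕ} (F : (Fin (n + 1) → Fin m) → ℝ) :
    ∑ h, F h = ∑ h : Fin n → Fin m, ∑ a, F (Fin.snoc h a : Fin (n + 1) → Fin m) := by
  rw [← (Fin.snocEquiv fun _ => Fin m).sum_comp, Fintype.sum_prod_type, Finset.sum_comm]
  rfl

namespace Quantity

theorem total_const_mul (q : Quantity) {m n : ℕ} (h : Fin n → Fin m) (c : ℝ) (g : ℕ → ℝ) :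
    q.total h (fun k => c * g k) = c * q.total h g := by
  cases q <;> simp [total, Finset.mul_sum]

theorem total_sub (q : Quantity) {m n : ℕ} (h : Fin n → Fin m) (f g : ℕ → ℝ) :
    q.total h (fun k => f k - g k) = q.total h f - q.total h g := by
  cases q <;> simp [total]

theorem total_mono (q : Quantity) {m n : ℕ} (h : Fin n → Fin m) {f g : ℕ → ℝ}
    (hfg : ∀ k, f k ≤ g k) : q.total h f ≤ q.total h g := by
  cases q <;> exact Finset.sum_le_sum fun _ _ => hfg _

theorem density_const_mul (q : Quantity) (m n : ℕ) (c : ℝ) (g : ℕ → ℝ) :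
    q.density m n (fun k => c * g k) = c * q.density m n g := by
  simp only [density, total_const_mul, ← Finset.mul_sum]
  ring

theorem density_sub (q : Quantity) (m n : ℕ) (f g : ℕ → ℝ) :
    q.density m n (fun k => f k - g k) = q.density m n f - q.density m n g := by
  simp only [density, total_sub, Finset.sum_sub_distrib]
  ring

theorem density_mono (q : Quantity) (m n : ℕ) {f g : ℕ → ℝ} (hfg : ∀ k, f k ≤ g k) :
    q.density m n f ≤ q.density m n g := by
  unfold density
  gcongr with h
  exact q.total_mono h hfg

variable {m n : ℕ}

theorem density_item_zero (Ξ : Policy) (m : ℕ) (g : ℕ → ℝ) :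
    (item Ξ).density m 0 g = 0 := by
  simp [density, total]

theorem density_unsuccessful_zero (Ξ : Policy) (hm : 0 < m) (g : ℕ → ℝ) :
    (unsuccessful Ξ).density m 0 g = g 0 := by
  have hm' : (m : ℝ) ≠ 0 := by exact_mod_cast hm.ne'
  have h0 : ∀ (h : Fin 0 → Fin m) (j : Fin m), unsuccessfulCost Ξ h j = 0 := by
    intro h j
    have hV := buildTable_valid Ξ (Nat.zero_le m) h
    exact (hV.cost_eq_zero_iff j).2 rfl
  simp only [density, total, h0]
  simp
  field_simp

theorem density_unsuccessful_succ (Ξ : Policy) (hn : n < m) (g : ℕ → ℝ) :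
    (unsuccessful Ξ).density m (n + 1) g = (unsuccessful Ξ).density m n g +
      1 / m * ((1 - n / m) * (g 1 - g 0) +
        (unsuccessful Ξ).density m n fun c => c * g (c + 1) - (c - 1) * g c - g 0) := by
  have hm' : (m : ℝ) ≠ 0 := by exact_mod_cast (by omega : m ≠ 0)
  have key : ∀ h : Fin n → Fin m, ∑ a, (unsuccessful Ξ).total (Fin.snoc h a : Fin (n + 1) → Fin m) g
      = m * (unsuccessful Ξ).total h g + (m - n) * (g 1 - g 0) +
        (unsuccessful Ξ).total h fun c => c * g (c + 1) - (c - 1) * g c - g 0 := by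
    intro h
    have := (buildTable_valid Ξ hn.le h).sum_cost_insert hn Ξ g
    simp only [total, unsuccessfulCost, buildTable_snoc]
    exact this
  simp only [density, sum_snoc, key, Finset.sum_add_distrib, Finset.sum_const, Finset.card_univ,
    Fintype.card_fun, Fintype.card_fin, nsmul_eq_mul, ← Finset.mul_sum]
  push_cast
  field_simp
  ring

theorem density_late_succ (hn : n < m) (g : ℕ → ℝ) :
    (item .late).density m (n + 1) g = (item .late).density m n g +
      1 / m * (unsuccessful .late).density m n g := by
  have hm' : (m : ℝ) ≠ 0 := by exact_mod_cast (by omega : m ≠ 0)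
  have key : ∀ h : Fin n → Fin m, ∑ a, (item .late).total (Fin.snoc h a : Fin (n + 1) → Fin m) g
      = m * (item .late).total h g + (unsuccessful .late).total h g := by
    intro h
    have := (buildTable_valid .late hn.le h).sum_disp_insert_late hn g
    simp only [total, itemDisplacement, buildTable_snoc]
    exact this
  simp only [density, sum_snoc, key, Finset.sum_add_distrib, ← Finset.mul_sum]
  field_simp
  ring

theorem density_early_succ (hn : n < m) (g : ℕ → ℝ) :
    (item .early).density m (n + 1) g = (item .early).density m n g +
      1 / m * ((item .early).density m n (fun d => d * (g (d + 1) - g d)) +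
        ((1 - n / m) * g 0 + n / m * g 1)) := by
  have hm' : (m : ℝ) ≠ 0 := by exact_mod_cast (by omega : m ≠ 0)
  have key : ∀ h : Fin n → Fin m, ∑ a, (item .early).total (Fin.snoc h a : Fin (n + 1) → Fin m) g
      = m * (item .early).total h g + (item .early).total h (fun d => d * (g (d + 1) - g d)) +
        ((m - n) * g 0 + n * g 1) := by
    intro h
    have := (buildTable_valid .early hn.le h).sum_disp_insert_early hn g
    simp only [total, itemDisplacement, buildTable_snoc]
    exact this
  simp only [density, sum_snoc, key, Finset.sum_add_distrib, Finset.sum_const, Finset.card_univ,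
    Fintype.card_fun, Fintype.card_fin, nsmul_eq_mul, ← Finset.mul_sum]
  push_cast
  field_simp
  ring

/-- The indicator function of `{k}`. -/
def indicatorAt (k c : ℕ) : ℝ := if c = k then 1 else 0

theorem density_unsuccessful_indicatorAt_zero (Ξ : Policy) (hm : 0 < m) (hn : n ≤ m) :
    (unsuccessful Ξ).density m n (indicatorAt 0) = 1 - n / m := by
  have hm' : (m : ℝ) ≠ 0 := by exact_mod_cast hm.ne'
  have : ∀ h : Fin n → Fin m, (unsuccessful Ξ).total h (indicatorAt 0) = m - n := by
    intro h
    have := (buildTable_valid Ξ hn h).sum_if_empty 1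
    rw [mul_one] at this
    exact this
  simp only [density, this, Finset.sum_const, Finset.card_univ, Fintype.card_fun, Fintype.card_fin,
    nsmul_eq_mul]
  push_cast
  field_simp
  ring

/-- The factor `c - 1` kills the loss term at cost `1`. The vanishing coefficient is written out to
match the form `y - c * x` of `euler_scheme_error`. -/
theorem density_unsuccessful_indicatorAt_one (Ξ : Policy) (hn : n < m) :
    (unsuccessful Ξ).density m (n + 1) (indicatorAt 1) =
      (unsuccessful Ξ).density m n (indicatorAt 1) +
        1 / m * ((1 - n / m) - 0 * (unsuccessful Ξ).density m n (indicatorAt 1)) := by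
  rw [density_unsuccessful_succ Ξ hn]
  have : (fun c : ℕ => (c : ℝ) * indicatorAt 1 (c + 1) - (c - 1) * indicatorAt 1 c -
      indicatorAt 1 0) = fun c => 0 * indicatorAt 1 c := by
    funext c
    rcases c with _ | _ | c <;> simp [indicatorAt]
  rw [this, density_const_mul]
  simp [indicatorAt]

theorem density_unsuccessful_indicatorAt_succ (Ξ : Policy) (hn : n < m) (k : ℕ) :
    (unsuccessful Ξ).density m (n + 1) (indicatorAt (k + 2)) =
      (unsuccessful Ξ).density m n (indicatorAt (k + 2)) +
        1 / m * ((k + 1) * (unsuccessful Ξ).density m n (indicatorAt (k + 1)) -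
          (k + 1) * (unsuccessful Ξ).density m n (indicatorAt (k + 2))) := by
  rw [density_unsuccessful_succ Ξ hn]
  have : (fun c : ℕ => (c : ℝ) * indicatorAt (k + 2) (c + 1) - (c - 1) * indicatorAt (k + 2) c -
      indicatorAt (k + 2) 0) =
      fun c => (k + 1) * indicatorAt (k + 1) c - (k + 1) * indicatorAt (k + 2) c := by
    funext c
    by_cases h1 : c = k + 1
    · subst h1; simp [indicatorAt]
    · by_cases h2 : c = k + 2
      · subst h2
        simp [indicatorAt]
        ring
      · simp [indicatorAt, h1, h2]
  rw [this, density_sub, density_const_mul, density_const_mul]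
  simp [indicatorAt]

theorem density_early_indicatorAt_zero (hn : n < m) :
    (item .early).density m (n + 1) (indicatorAt 0) =
      (item .early).density m n (indicatorAt 0) +
        1 / m * ((1 - n / m) - 0 * (item .early).density m n (indicatorAt 0)) := by
  rw [density_early_succ hn]
  have : (fun d : ℕ => (d : ℝ) * (indicatorAt 0 (d + 1) - indicatorAt 0 d)) =
      fun d => 0 * indicatorAt 0 d := by
    funext d
    rcases d with _ | d <;> simp [indicatorAt]
  rw [this, density_const_mul]
  simp [indicatorAt]

theorem density_early_indicatorAt_one (hn : n < m) :
    (item .early).density m (n + 1) (indicatorAt 1) =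
      (item .early).density m n (indicatorAt 1) +
        1 / m * (n / m - 1 * (item .early).density m n (indicatorAt 1)) := by
  rw [density_early_succ hn]
  have : (fun d : ℕ => (d : ℝ) * (indicatorAt 1 (d + 1) - indicatorAt 1 d)) =
      fun d => (-1) * indicatorAt 1 d := by
    funext d
    rcases d with _ | _ | d <;> simp [indicatorAt]
  rw [this, density_const_mul]
  simp only [indicatorAt, zero_ne_one, if_false, if_true]
  ring

theorem density_early_indicatorAt_succ (hn : n < m) (k : ℕ) :
    (item .early).density m (n + 1) (indicatorAt (k + 2)) =
      (item .early).density m n (indicatorAt (k + 2)) +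
        1 / m * ((k + 1) * (item .early).density m n (indicatorAt (k + 1)) -
          (k + 2) * (item .early).density m n (indicatorAt (k + 2))) := by
  rw [density_early_succ hn]
  have : (fun d : ℕ => (d : ℝ) * (indicatorAt (k + 2) (d + 1) - indicatorAt (k + 2) d)) =
      fun d => (k + 1) * indicatorAt (k + 1) d - (k + 2) * indicatorAt (k + 2) d := by
    funext d
    by_cases h1 : d = k + 1
    · subst h1; simp [indicatorAt]
    · by_cases h2 : d = k + 2
      · subst h2; simp [indicatorAt]
      · simp [indicatorAt, h1, h2]
  rw [this, density_sub, density_const_mul, density_const_mul]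
  simp [indicatorAt]

/-! ### Error bounds for the point densities -/

/-- The limit of the density at load factor `t`. -/
noncomputable def limitDensity (q : Quantity) (k : ℕ) (t : ℝ) : ℝ :=
  match q with
  | .item _ => t * q.limit t k
  | .unsuccessful _ => q.limit t k

/-- The system is triangular: level `k + 2` is driven by level `k + 1` alone, whose error `A * n / m
^ 2 ≤ A / m` is an admissible input error. Level `0` is exact, since the number of empty cells is
deterministic. -/
theorem density_unsuccessful_error (Ξ : Policy) (k : ℕ) :
    ∃ B, 0 ≤ B ∧ ∀ m n : ℕ, 0 < m → k ≤ m → n ≤ m →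
      |(unsuccessful Ξ).density m n (indicatorAt k) - limitU (n / m) k| ≤ B * n / m ^ 2 := by
  match k with
  | 0 =>
    refine ⟨0, le_rfl, fun m n hm _ hn => ?_⟩
    simp [density_unsuccessful_indicatorAt_zero Ξ hm hn, limitU]
  | 1 =>
    obtain ⟨B, hB, h⟩ := euler_scheme_error (u := fun t => limitU t 1) (v := fun t => 1 - t)
      (c := 0) le_rfl (fun t => by simpa using hasDerivAt_limitU_one t) (by fun_prop) le_rfl
    refine ⟨B, hB, fun m n hm _ hn => ?_⟩
    refine h m (fun n => (unsuccessful Ξ).density m n (indicatorAt 1)) (fun n => 1 - n / m) hm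
      (by positivity) ?_ (fun n hn => density_unsuccessful_indicatorAt_one Ξ hn) ?_ n hn
    · simp [density_unsuccessful_zero Ξ hm, limitU, indicatorAt]
    · intro n _
      simp
  | k + 2 =>
    obtain ⟨A, hA, ih⟩ := density_unsuccessful_error Ξ (k + 1)
    obtain ⟨B, hB, h⟩ := euler_scheme_error (u := fun t => limitU t (k + 2))
      (v := fun t => (k + 1) * limitU t (k + 1)) (c := k + 1) (by positivity)
      (hasDerivAt_limitU_succ k) (contDiff_const.mul (contDiff_limitU (k + 1)))
      (A := (k + 1) * A) (by positivity)
    refine ⟨B, hB, fun m n hm hk hn => ?_⟩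
    refine h m (fun n => (unsuccessful Ξ).density m n (indicatorAt (k + 2)))
      (fun n => (k + 1) * (unsuccessful Ξ).density m n (indicatorAt (k + 1))) hm
      ?_ ?_ (fun n hn => density_unsuccessful_indicatorAt_succ Ξ hn k) ?_ n hn
    · exact_mod_cast (by omega : k + 1 ≤ m)
    · simp [density_unsuccessful_zero Ξ hm, limitU, indicatorAt]
    · intro n hn
      exact abs_const_mul_sub_le_div (by positivity) hm hn.le hA (ih m n hm (by omega) hn.le)

theorem density_late_error (k : ℕ) :
    ∃ B, 0 ≤ B ∧ ∀ m n : ℕ, 0 < m → k ≤ m → n ≤ m →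
      |(item .late).density m n (indicatorAt k) - n / m * limitL (n / m) k| ≤
        B * n / m ^ 2 := by
  obtain ⟨A, hA, hU⟩ := density_unsuccessful_error .late k
  obtain ⟨B, hB, h⟩ := euler_scheme_error (u := fun t => t * limitL t k)
    (v := fun t => limitU t k) (c := 0) le_rfl
    (fun t => by simpa using hasDerivAt_mul_limitL k t) (contDiff_limitU k) hA
  refine ⟨B, hB, fun m n hm hk hn => ?_⟩
  refine h m (fun n => (item .late).density m n (indicatorAt k))
    (fun n => (unsuccessful .late).density m n (indicatorAt k)) hm
    (by positivity) ?_ (fun n hn => ?_) ?_ n hn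
  · simp [density_item_zero]
  · simp [density_late_succ hn]
  · intro n hn
    simpa using abs_const_mul_sub_le_div zero_le_one hm hn.le hA (hU m n hm hk hn.le)

theorem density_early_error (k : ℕ) :
    ∃ B, 0 ≤ B ∧ ∀ m n : ℕ, 0 < m → k ≤ m → n ≤ m →
      |(item .early).density m n (indicatorAt k) - n / m * limitE (n / m) k| ≤
        B * n / m ^ 2 := by
  match k with
  | 0 =>
    obtain ⟨B, hB, h⟩ := euler_scheme_error (u := fun t => t * limitE t 0) (v := fun t => 1 - t)
      (c := 0) le_rfl (fun t => by simpa using hasDerivAt_mul_limitE_zero t) (by fun_prop) le_rfl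
    refine ⟨B, hB, fun m n hm _ hn => ?_⟩
    refine h m (fun n => (item .early).density m n (indicatorAt 0)) (fun n => 1 - n / m) hm
      (by positivity) ?_ (fun n hn => density_early_indicatorAt_zero hn) ?_ n hn
    · simp [density_item_zero]
    · intro n _
      simp
  | 1 =>
    obtain ⟨B, hB, h⟩ := euler_scheme_error (u := fun t => t * limitE t 1) (v := fun t => t)
      (c := 1) zero_le_one hasDerivAt_mul_limitE_one (by fun_prop) le_rfl
    refine ⟨B, hB, fun m n hm hk hn => ?_⟩
    refine h m (fun n => (item .early).density m n (indicatorAt 1)) (fun n => n / m) hm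
      (by exact_mod_cast hk) ?_ (fun n hn => density_early_indicatorAt_one hn) ?_ n hn
    · simp [density_item_zero]
    · intro n _
      simp
  | k + 2 =>
    obtain ⟨A, hA, ih⟩ := density_early_error (k + 1)
    obtain ⟨B, hB, h⟩ := euler_scheme_error (u := fun t => t * limitE t (k + 2))
      (v := fun t => (k + 1) * (t * limitE t (k + 1))) (c := k + 2) (by positivity)
      (hasDerivAt_mul_limitE_succ k) (contDiff_const.mul (contDiff_mul_limitE (k + 1)))
      (A := (k + 1) * A) (by positivity)
    refine ⟨B, hB, fun m n hm hk hn => ?_⟩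
    refine h m (fun n => (item .early).density m n (indicatorAt (k + 2)))
      (fun n => (k + 1) * (item .early).density m n (indicatorAt (k + 1))) hm
      ?_ ?_ (fun n hn => density_early_indicatorAt_succ hn k) ?_ n hn
    · exact_mod_cast hk
    · simp [density_item_zero]
    · intro n hn
      exact abs_const_mul_sub_le_div (by positivity) hm hn.le hA (ih m n hm (by omega) hn.le)

theorem density_error (q : Quantity) (k : ℕ) :
    ∃ B, 0 ≤ B ∧ ∀ m n : ℕ, 0 < m → k ≤ m → n ≤ m →
      |q.density m n (indicatorAt k) - q.limitDensity k (n / m)| ≤ B * n / m ^ 2 := by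
  match q with
  | .item .late => exact density_late_error k
  | .item .early => exact density_early_error k
  | .unsuccessful Ξ => exact density_unsuccessful_error Ξ k

/-! ### Uniform moment bounds -/

/-- The rising factorial `c (c + 1) ⋯ (c + p)`. -/
def rising (p c : ℕ) : ℝ := (c.ascFactorial (p + 1) : ℝ)

theorem rising_zero (p : ℕ) : rising p 0 = 0 := by
  simp [rising, Nat.zero_ascFactorial]

theorem rising_one (p : ℕ) : rising p 1 = (p + 1).factorial := by
  simp [rising, Nat.one_ascFactorial]

theorem rising_nonneg (p c : ℕ) : 0 ≤ rising p c := Nat.cast_nonneg _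

theorem pow_le_rising (p c : ℕ) : (c : ℝ) ^ (p + 1) ≤ rising p c := by
  unfold rising
  exact_mod_cast Nat.pow_succ_le_ascFactorial c (p + 1)

/-- Both sides are the product of `c, …, c + p + 1`. Rising factorials are thus eigenfunctions of
the one-step operators, with eigenvalue `p + 2` for unsuccessful searches and `p + 1` for early
displacements, so each moment recursion closes by itself. -/
theorem mul_rising_succ (p c : ℕ) : c * rising p (c + 1) = (c + p + 1) * rising p c := by
  have h := Nat.succ_ascFactorial c (p + 1)
  have h' : (c : ℝ) * ((c + 1).ascFactorial (p + 1) : ℕ) =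
      (c + (p + 1)) * (c.ascFactorial (p + 1) : ℕ) := by exact_mod_cast h
  simp only [rising]
  rw [h']
  ring

theorem density_unsuccessful_rising_le (Ξ : Policy) (p : ℕ) :
    ∃ C, 0 ≤ C ∧ ∀ m n : ℕ, 0 < m → n ≤ m →
      (unsuccessful Ξ).density m n (rising p) ≤ C * (n / m) := by
  refine ⟨_, ?_, fun m n hm hn => le_of_succ_le (C := p + 2) (D := (p + 1).factorial)
    (by positivity) (by positivity) hm
    (x := fun n => (unsuccessful Ξ).density m n (rising p)) ?_ (fun n hn => ?_) hn⟩
  · positivity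
  · simp [density_unsuccessful_zero Ξ hm, rising_zero]
  · simp only [density_unsuccessful_succ Ξ hn]
    have : (fun c : ℕ => (c : ℝ) * rising p (c + 1) - (c - 1) * rising p c - rising p 0) =
        fun c => (p + 2) * rising p c := by
      funext c
      rw [mul_rising_succ, rising_zero]
      ring
    rw [this, density_const_mul, rising_zero, rising_one]
    have h1 : (1 - (n : ℝ) / m) * ((p + 1).factorial - 0) ≤ (p + 1).factorial := by
      rw [sub_zero]
      refine mul_le_of_le_one_left (by positivity) ?_
      have : 0 ≤ (n : ℝ) / m := by positivity
      linarith
    have h2 : 1 / (m : ℝ) * ((1 - (n : ℝ) / m) * ((p + 1).factorial - 0)) ≤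
        1 / m * (p + 1).factorial := by gcongr
    calc _ = (1 + (p + 2) / (m : ℝ)) * (unsuccessful Ξ).density m n (rising p) +
          1 / (m : ℝ) * ((1 - (n : ℝ) / m) * ((p + 1).factorial - 0)) := by ring
      _ ≤ (1 + (p + 2) / (m : ℝ)) * (unsuccessful Ξ).density m n (rising p) +
          1 / m * (p + 1).factorial := by gcongr
      _ = _ := by ring

theorem density_late_rising_le (p : ℕ) :
    ∃ C, 0 ≤ C ∧ ∀ m n : ℕ, 0 < m → n ≤ m →
      (item .late).density m n (rising p) ≤ C * (n / m) := by
  obtain ⟨C, hC, h⟩ := density_unsuccessful_rising_le .late p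
  refine ⟨_, ?_, fun m n hm hn => le_of_succ_le (C := 0) (D := C) le_rfl hC hm
    (x := fun n => (item .late).density m n (rising p)) ?_ (fun n hn => ?_) hn⟩
  · positivity
  · simp [density_item_zero]
  · simp only [density_late_succ hn]
    have hm' : (0 : ℝ) < m := by exact_mod_cast hm
    have h1 : (unsuccessful .late).density m n (rising p) ≤ C := by
      refine (h m n hm hn.le).trans (mul_le_of_le_one_right hC ?_)
      rw [div_le_one hm']
      exact_mod_cast hn.le
    have h2 : 1 / (m : ℝ) * (unsuccessful .late).density m n (rising p) ≤ 1 / m * C := by gcongr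
    calc _ ≤ (item .late).density m n (rising p) + 1 / m * C := by gcongr
      _ = _ := by ring

theorem density_early_rising_le (p : ℕ) :
    ∃ C, 0 ≤ C ∧ ∀ m n : ℕ, 0 < m → n ≤ m →
      (item .early).density m n (rising p) ≤ C * (n / m) := by
  refine ⟨_, ?_, fun m n hm hn => le_of_succ_le (C := p + 1) (D := (p + 1).factorial)
    (by positivity) (by positivity) hm
    (x := fun n => (item .early).density m n (rising p)) ?_ (fun n hn => ?_) hn⟩
  · positivity
  · simp [density_item_zero]
  · simp only [density_early_succ hn]
    have hm' : (0 : ℝ) < m := by exact_mod_cast hm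
    have : (fun d : ℕ => (d : ℝ) * (rising p (d + 1) - rising p d)) =
        fun d => (p + 1) * rising p d := by
      funext d
      rw [mul_sub, mul_rising_succ]
      ring
    rw [this, density_const_mul, rising_zero, rising_one]
    have h1 : (n : ℝ) / m * (p + 1).factorial ≤ (p + 1).factorial := by
      refine mul_le_of_le_one_left (by positivity) ?_
      rw [div_le_one hm']
      exact_mod_cast hn.le
    have h2 : 1 / (m : ℝ) * ((n : ℝ) / m * (p + 1).factorial) ≤ 1 / m * (p + 1).factorial := by
      gcongr
    calc _ = (1 + (p + 1) / (m : ℝ)) * (item .early).density m n (rising p) +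
          1 / (m : ℝ) * ((n : ℝ) / m * (p + 1).factorial) := by ring
      _ ≤ (1 + (p + 1) / (m : ℝ)) * (item .early).density m n (rising p) +
          1 / m * (p + 1).factorial := by gcongr
      _ = _ := by ring

theorem density_rising_le (q : Quantity) (p : ℕ) :
    ∃ C, 0 ≤ C ∧ ∀ m n : ℕ, 0 < m → n ≤ m → q.density m n (rising p) ≤ C * (n / m) := by
  match q with
  | .item .late => exact density_late_rising_le p
  | .item .early => exact density_early_rising_le p
  | .unsuccessful Ξ => exact density_unsuccessful_rising_le Ξ p

end Quantity

/-! ### From densities to probabilities -/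

section Expectation

variable {m n : ℕ} [NeZero m] [NeZero n]

theorem integral_sampleMeasure (f : Sample m n → ℝ) :
    ∫ ω, f ω ∂(sampleMeasure m n) = (∑ h, ∑ i, ∑ j, f (h, i, j)) / ((m : ℝ) ^ n * (n * m)) := by
  have hreal : ∀ ω : Sample m n, (sampleMeasure m n).real {ω} = ((m : ℝ) ^ n * (n * m))⁻¹ := by
    intro ω
    rw [measureReal_def, sampleMeasure, uniformOn_univ, Measure.count_singleton]
    simp [Fintype.card_prod]
  rw [integral_fintype Integrable.of_finite]
  simp only [hreal, smul_eq_mul, ← Finset.mul_sum, Fintype.sum_prod_type]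
  ring

namespace Quantity

variable (q : Quantity)

theorem size_pos : 0 < q.size m n := by
  cases q
  · exact NeZero.pos n
  · exact NeZero.pos m

theorem integral_comp_value (g : ℕ → ℝ) :
    ∫ ω, g (q.value ω) ∂(sampleMeasure m n) = q.density m n g * (m / q.size m n) := by
  have hm : (m : ℝ) ≠ 0 := NeZero.ne _
  have hn : (n : ℝ) ≠ 0 := NeZero.ne _
  rw [integral_sampleMeasure]
  cases q <;>
  · simp only [value, density, total, size, Finset.sum_const, Finset.card_univ, Fintype.card_fin,
      nsmul_eq_mul, ← Finset.mul_sum]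
    field_simp
    try ring

theorem integral_comp_fst (F : (Fin n → Fin m) → ℝ) :
    ∫ ω, F ω.1 ∂(sampleMeasure m n) = (∑ h, F h) / (m : ℝ) ^ n := by
  have hm : (m : ℝ) ≠ 0 := NeZero.ne _
  have hn : (n : ℝ) ≠ 0 := NeZero.ne _
  rw [integral_sampleMeasure]
  simp only [Finset.sum_const, Finset.card_univ, Fintype.card_fin, nsmul_eq_mul, ← Finset.mul_sum]
  field_simp

omit [NeZero m] [NeZero n] in
theorem measurable_value : Measurable fun ω : Sample m n => q.value ω := measurable_of_finite _

omit [NeZero m] [NeZero n] in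
theorem prob_eq_integral (k : ℕ) : (sampleMeasure m n).real {ω | q.value ω = k} =
    ∫ ω, indicatorAt k (q.value ω) ∂(sampleMeasure m n) := by
  have hms : MeasurableSet {ω : Sample m n | q.value ω = k} :=
    Set.Finite.measurableSet (Set.toFinite _)
  rw [← integral_indicator_one hms]
  congr 1
  funext ω
  by_cases h : q.value ω = k <;> simp [indicatorAt, h]

theorem prob_eq (k : ℕ) : (sampleMeasure m n).real {ω | q.value ω = k} =
    q.density m n (indicatorAt k) * (m / q.size m n) := by
  rw [prob_eq_integral, integral_comp_value]

omit [NeZero m] [NeZero n] in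
theorem count_eq_total (h : Fin n → Fin m) (k : ℕ) :
    (q.count h k : ℝ) = q.total h (indicatorAt k) := by
  cases q <;>
  · simp only [count, total, indicatorAt, Finset.sum_boole]
    rw [Set.ncard_eq_toFinset_card']
    congr 2
    ext
    simp

theorem prob_eq_integral_count (k : ℕ) : (sampleMeasure m n).real {ω | q.value ω = k} =
    1 / (q.size m n : ℝ) * ∫ ω, (q.count ω.1 k : ℝ) ∂(sampleMeasure m n) := by
  have hm : (m : ℝ) ≠ 0 := NeZero.ne _
  rw [prob_eq, integral_comp_fst (fun h => (q.count h k : ℝ))]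
  simp only [count_eq_total, density]
  field_simp
  ring

/-- Markov's inequality with a rising factorial dominating the power. Passing to probabilities
multiplies by `m / q.size m n`, which the bound linear in `n / m` absorbs even for items in sparse
tables. -/
theorem prob_mul_pow_le (p : ℕ) : ∃ C, 0 ≤ C ∧ ∀ (m n : ℕ) [NeZero m] [NeZero n], n ≤ m → ∀ k : ℕ,
    (sampleMeasure m n).real {ω | q.value ω = k} * (k : ℝ) ^ (p + 1) ≤ C := by
  obtain ⟨C, hC, h⟩ := q.density_rising_le p
  refine ⟨C, hC, fun m n _ _ hn k => ?_⟩
  have hm0 : (0 : ℝ) < m := by exact_mod_cast NeZero.pos m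
  have hn0 : (0 : ℝ) < n := by exact_mod_cast NeZero.pos n
  have hs0 : (0 : ℝ) < q.size m n := by exact_mod_cast q.size_pos
  have h1 : q.density m n (fun c => (k : ℝ) ^ (p + 1) * indicatorAt k c) ≤
      q.density m n (rising p) := by
    refine q.density_mono m n fun c => ?_
    by_cases hc : c = k
    · subst hc
      simpa [indicatorAt] using pow_le_rising p c
    · simpa [indicatorAt, hc] using rising_nonneg p c
  rw [density_const_mul] at h1
  rw [prob_eq]
  calc q.density m n (indicatorAt k) * (m / q.size m n) * (k : ℝ) ^ (p + 1)
      = ((k : ℝ) ^ (p + 1) * q.density m n (indicatorAt k)) * (m / q.size m n) := by ring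
    _ ≤ C * (n / m) * (m / q.size m n) :=
      mul_le_mul_of_nonneg_right (h1.trans (h m n (NeZero.pos m) hn)) (by positivity)
    _ = C * (n / q.size m n) := by field_simp
    _ ≤ C := by
      refine mul_le_of_le_one_right hC ?_
      rw [div_le_one hs0]
      cases q
      · exact le_rfl
      · exact_mod_cast hn

theorem prob_mul_succ_pow_le (p : ℕ) : ∃ C, 0 ≤ C ∧ ∀ (m n : ℕ) [NeZero m] [NeZero n], n ≤ m →
    ∀ k : ℕ, (sampleMeasure m n).real {ω | q.value ω = k} * ((k : ℝ) + 1) ^ (p + 1) ≤ C := by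
  obtain ⟨C, hC, h⟩ := q.prob_mul_pow_le p
  -- The power of two comes from `k + 1 ≤ 2 * k` for `k ≥ 1`; the added `1` covers `k = 0`.
  refine ⟨2 ^ (p + 1) * C + 1, by positivity, fun m n _ _ hn k => ?_⟩
  have hP : (sampleMeasure m n).real {ω | q.value ω = k} ≤ 1 := measureReal_le_one
  rcases Nat.eq_zero_or_pos k with rfl | hk
  · have : 0 ≤ 2 ^ (p + 1) * C := by positivity
    simp only [CharP.cast_eq_zero, zero_add, one_pow, mul_one]
    linarith
  · have hk' : (1 : ℝ) ≤ k := by exact_mod_cast hk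
    calc (sampleMeasure m n).real {ω | q.value ω = k} * ((k : ℝ) + 1) ^ (p + 1)
        ≤ (sampleMeasure m n).real {ω | q.value ω = k} * (2 * k : ℝ) ^ (p + 1) := by
          gcongr
          linarith
      _ = 2 ^ (p + 1) * ((sampleMeasure m n).real {ω | q.value ω = k} * (k : ℝ) ^ (p + 1)) := by
          rw [mul_pow]
          ring
      _ ≤ 2 ^ (p + 1) * C := by
          gcongr
          exact h m n hn k
      _ ≤ 2 ^ (p + 1) * C + 1 := by linarith

end Quantity

end Expectation

/-! ### Passage to the limit -/

section Limits

theorem hasDerivAt_mul_limit_item (Ξ : Policy) (k : ℕ) :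
    HasDerivAt (fun t => t * (Quantity.item Ξ).limit t k) ((Quantity.item Ξ).limit 0 k) 0 := by
  match Ξ, k with
  | .late, 0 =>
    exact (hasDerivAt_mul_limitL 0 0).congr_deriv (by simp [Quantity.limit, limitL, limitU])
  | .late, k + 1 =>
    exact (hasDerivAt_mul_limitL (k + 1) 0).congr_deriv (by simp [Quantity.limit, limitL, limitU])
  | .early, 0 =>
    exact (hasDerivAt_mul_limitE_zero 0).congr_deriv (by simp [Quantity.limit, limitE])
  | .early, 1 =>
    exact (hasDerivAt_mul_limitE_one 0).congr_deriv (by simp [Quantity.limit, limitE])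
  | .early, k + 2 =>
    exact (hasDerivAt_mul_limitE_succ k 0).congr_deriv (by simp [Quantity.limit, limitE])

theorem continuous_mul_limit_item (Ξ : Policy) (k : ℕ) :
    Continuous fun t => t * (Quantity.item Ξ).limit t k := by
  cases Ξ with
  | late =>
    exact continuous_iff_continuousAt.2 fun t => (hasDerivAt_mul_limitL k t).continuousAt
  | early => exact (contDiff_mul_limitE k).continuous

/-- For items, continuity is known only after multiplication by the load. At `α = 0` the quotient is
a difference quotient of that product, and the conventional value of the limit law at load `0` is
its derivative. -/
theorem tendsto_limit (q : Quantity) (k : ℕ) {t : ℕ → ℝ} {α : ℝ} (ht0 : ∀ j, t j ≠ 0)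
    (ht : Tendsto t atTop (𝓝 α)) :
    Tendsto (fun j => q.limit (t j) k) atTop (𝓝 (q.limit α k)) := by
  cases q with
  | unsuccessful Ξ => exact ((contDiff_limitU k).continuous.tendsto α).comp ht
  | item Ξ =>
    by_cases hα : α = 0
    · subst hα
      have h1 := hasDerivAt_iff_tendsto_slope.1 (hasDerivAt_mul_limit_item Ξ k)
      have h2 : Tendsto t atTop (𝓝[≠] 0) :=
        tendsto_nhdsWithin_iff.2 ⟨ht, Eventually.of_forall ht0⟩
      refine (h1.comp h2).congr fun j => ?_
      have := ht0 j
      simp only [Function.comp, slope_def_field, zero_mul, sub_zero]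
      field_simp
    · have h1 := (((continuous_mul_limit_item Ξ k).tendsto α).comp ht).div ht hα
      rw [mul_div_cancel_left₀ _ hα] at h1
      refine h1.congr fun j => ?_
      exact mul_div_cancel_left₀ _ (ht0 j)

variable {m n : ℕ → ℕ} [∀ j, NeZero (m j)] [∀ j, NeZero (n j)] {α : ℝ}

theorem Quantity.tendsto_prob (q : Quantity) (hnm : ∀ j, n j ≤ m j) (hm : Tendsto m atTop atTop)
    (hα : Tendsto (fun j => (n j : ℝ) / (m j : ℝ)) atTop (𝓝 α)) (k : ℕ) :
    Tendsto (fun j => (sampleMeasure (m j) (n j)).real {ω | q.value ω = k}) atTop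
      (𝓝 (q.limit α k)) := by
  have hm0 : ∀ j, (0 : ℝ) < m j := fun j => by exact_mod_cast NeZero.pos (m j)
  have hn0 : ∀ j, (0 : ℝ) < n j := fun j => by exact_mod_cast NeZero.pos (n j)
  have hlim := tendsto_limit q k (t := fun j => (n j : ℝ) / (m j : ℝ))
    (fun j => (div_pos (hn0 j) (hm0 j)).ne') hα
  obtain ⟨B, hB, h⟩ := q.density_error k
  have hBm : Tendsto (fun j => B / (m j : ℝ)) atTop (𝓝 0) :=
    tendsto_const_nhds.div_atTop (tendsto_natCast_atTop_atTop.comp hm)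
  have herr : Tendsto (fun j => (sampleMeasure (m j) (n j)).real {ω | q.value ω = k} -
      q.limit ((n j : ℝ) / (m j : ℝ)) k) atTop (𝓝 0) := by
    refine squeeze_zero_norm' ?_ hBm
    filter_upwards [hm.eventually_ge_atTop k] with j hj
    have hs0 : (0 : ℝ) < q.size (m j) (n j) := by exact_mod_cast q.size_pos
    have hid : q.limit ((n j : ℝ) / (m j : ℝ)) k =
        q.limitDensity k ((n j : ℝ) / (m j : ℝ)) * (m j / q.size (m j) (n j)) := by
      have := (hm0 j).ne'
      have := (hn0 j).ne'
      cases q <;> simp only [limitDensity, size] <;> field_simp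
    have hsn : (n j : ℝ) ≤ q.size (m j) (n j) := by
      cases q
      · exact le_rfl
      · exact_mod_cast hnm j
    rw [Quantity.prob_eq, hid, ← sub_mul, Real.norm_eq_abs, abs_mul,
      abs_of_pos (div_pos (hm0 j) hs0)]
    calc |q.density (m j) (n j) (indicatorAt k) - q.limitDensity k ((n j : ℝ) / (m j : ℝ))| *
          (m j / q.size (m j) (n j))
        ≤ B * n j / m j ^ 2 * (m j / q.size (m j) (n j)) := by
          gcongr
          exact h (m j) (n j) (NeZero.pos _) hj (hnm j)
      _ = B / m j * (n j / q.size (m j) (n j)) := by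
          have := (hm0 j).ne'
          field_simp
      _ ≤ B / m j := by
          refine mul_le_of_le_one_right (div_nonneg hB (hm0 j).le) ?_
          rwa [div_le_one hs0]
  simpa using herr.add hlim

theorem summable_one_div_succ_sq (C : ℝ) : Summable fun k : ℕ => C * (1 / ((k : ℝ) + 1) ^ 2) := by
  have h := (summable_nat_add_iff 1).2 (Real.summable_one_div_nat_pow.2 one_lt_two)
  refine (h.mul_left C).congr fun k => ?_
  push_cast
  rfl

theorem mul_abs_le_of_mul_pow_le {p K C x g : ℝ} {s : ℕ} (hp : 0 ≤ p) (hx : 0 ≤ x)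
    (hK : 0 ≤ K) (hg : |g| ≤ K * (x + 1) ^ s) (hC : p * (x + 1) ^ (s + 1 + 1) ≤ C) :
    p * |g| ≤ K * C * (1 / (x + 1) ^ 2) := by
  have hpos : 0 < (x + 1) ^ 2 := by positivity
  rw [mul_one_div, le_div_iff₀ hpos]
  calc p * |g| * (x + 1) ^ 2 ≤ p * (K * (x + 1) ^ s) * (x + 1) ^ 2 := by gcongr
    _ = K * (p * (x + 1) ^ (s + 1 + 1)) := by ring
    _ ≤ K * C := by gcongr

theorem Quantity.tendsto_tsum (q : Quantity) (hnm : ∀ j, n j ≤ m j) (hm : Tendsto m atTop atTop)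
    (hα : Tendsto (fun j => (n j : ℝ) / (m j : ℝ)) atTop (𝓝 α)) {g : ℕ → ℝ} {K : ℝ} (hK : 0 ≤ K)
    {s : ℕ} (hg : ∀ k : ℕ, |g k| ≤ K * ((k : ℝ) + 1) ^ s) :
    Summable (fun k => q.limit α k * |g k|) ∧
    Tendsto (fun j => ∑' k, (sampleMeasure (m j) (n j)).real {ω | q.value ω = k} * g k) atTop
      (𝓝 (∑' k, q.limit α k * g k)) := by
  -- This gives decay of order `s + 2`, two powers beyond the growth of `g`, leaving a summable
  -- majorant.
  obtain ⟨C, hC, h⟩ := q.prob_mul_succ_pow_le (s + 1)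
  have hprob := q.tendsto_prob hnm hm hα
  have hlim0 : ∀ k, 0 ≤ q.limit α k := fun k =>
    ge_of_tendsto' (hprob k) fun j => measureReal_nonneg
  have hlimC : ∀ k : ℕ, q.limit α k * ((k : ℝ) + 1) ^ (s + 1 + 1) ≤ C := fun k =>
    le_of_tendsto' ((hprob k).mul_const _) fun j => h (m j) (n j) (hnm j) k
  constructor
  · refine Summable.of_nonneg_of_le (fun k => mul_nonneg (hlim0 k) (abs_nonneg _)) (fun k => ?_)
      (summable_one_div_succ_sq (K * C))
    exact mul_abs_le_of_mul_pow_le (hlim0 k) (Nat.cast_nonneg k) hK (hg k) (hlimC k)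
  · refine tendsto_tsum_of_dominated_convergence (summable_one_div_succ_sq (K * C))
      (fun k => (hprob k).mul_const (g k)) (Eventually.of_forall fun j k => ?_)
    rw [norm_mul, Real.norm_eq_abs, Real.norm_eq_abs, abs_of_nonneg measureReal_nonneg]
    exact mul_abs_le_of_mul_pow_le measureReal_nonneg (Nat.cast_nonneg k) hK (hg k)
      (h (m j) (n j) (hnm j) k)

theorem integrable_comp_of_summable {Ω : Type*} [MeasurableSpace Ω] {P : Measure Ω}
    [IsFiniteMeasure P] {D : Ω → ℕ} (hD : Measurable D) {g : ℕ → ℝ}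
    (hs : Summable fun k => P.real {ω | D ω = k} * |g k|) : Integrable (fun ω => g (D ω)) P := by
  have hmap : ∀ k : ℕ, (P.map D) {k} = P {ω | D ω = k} := fun k =>
    Measure.map_apply hD (measurableSet_singleton k)
  have : Integrable g (P.map D) := by
    rw [← Measure.sum_smul_dirac (P.map D)]
    refine integrable_sum_dirac (fun k => measure_ne_top _ _) ?_
    simpa only [hmap, Real.norm_eq_abs, measureReal_def] using hs
  exact this.comp_measurable hD

theorem integral_comp_eq_tsum {Ω : Type*} [MeasurableSpace Ω] {P : Measure Ω}
    {D : Ω → ℕ} (hD : Measurable D) {g : ℕ → ℝ} (hg : Integrable (fun ω => g (D ω)) P) :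
    ∫ ω, g (D ω) ∂P = ∑' k, P.real {ω | D ω = k} * g k := by
  have hm : AEStronglyMeasurable g (P.map D) := (measurable_from_nat).aestronglyMeasurable
  rw [← integral_map hD.aemeasurable hm,
    integral_countable ((integrable_map_measure hm hD.aemeasurable).2 hg)]
  refine tsum_congr fun k => ?_
  rw [map_measureReal_apply hD (measurableSet_singleton k)]
  rfl

theorem Quantity.tendsto_integral (q : Quantity) (hnm : ∀ j, n j ≤ m j)
    (hm : Tendsto m atTop atTop)
    (hα : Tendsto (fun j => (n j : ℝ) / (m j : ℝ)) atTop (𝓝 α)) {Ω : Type*} [MeasurableSpace Ω]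
    {P : Measure Ω} [IsProbabilityMeasure P] {D : Ω → ℕ} (hD : Measurable D)
    (hP : ∀ k, P.real {ω | D ω = k} = q.limit α k) {g : ℕ → ℝ} {K : ℝ} (hK : 0 ≤ K)
    {s : ℕ} (hg : ∀ k : ℕ, |g k| ≤ K * ((k : ℝ) + 1) ^ s) :
    Integrable (fun ω => g (D ω)) P ∧
    Tendsto (fun j => ∫ ω, g (q.value ω) ∂(sampleMeasure (m j) (n j))) atTop
      (𝓝 (∫ ω, g (D ω) ∂P)) := by
  obtain ⟨h1, h2⟩ := q.tendsto_tsum hnm hm hα hK hg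
  have hint : Integrable (fun ω => g (D ω)) P := by
    refine integrable_comp_of_summable hD ?_
    simpa only [hP] using h1
  refine ⟨hint, ?_⟩
  rw [integral_comp_eq_tsum hD hint]
  simp only [hP]
  refine h2.congr fun j => ?_
  exact (integral_comp_eq_tsum q.measurable_value Integrable.of_finite).symm

/-- Both properties are inherited from the finite tables along one sequence of loads tending to `α`,
with no integral evaluated: limits of probabilities are nonnegative, and domination prevents mass
from escaping. -/
theorem Quantity.limit_isProbability (q : Quantity) {α : ℝ} (hα : α ∈ Set.Icc (0 : ℝ) 1) :
    (∀ k, 0 ≤ q.limit α k) ∧ HasSum (q.limit α) 1 := by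
  let m : ℕ → ℕ := fun j => j + 1
  -- The maximum keeps the table nonempty, also at `α = 0`, without changing the limiting load.
  let n : ℕ → ℕ := fun j => max 1 ⌊α * (j + 1 : ℕ)⌋₊
  have : ∀ j, NeZero (m j) := fun j => ⟨Nat.succ_ne_zero j⟩
  have : ∀ j, NeZero (n j) := fun j => ⟨by simp [n]⟩
  have hnm : ∀ j, n j ≤ m j := by
    intro j
    refine max_le (by simp [m]) (Nat.floor_le_of_le ?_)
    exact mul_le_of_le_one_left (Nat.cast_nonneg _) hα.2
  have hm : Tendsto m atTop atTop := tendsto_add_atTop_nat 1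
  have hmr : Tendsto (fun j => (m j : ℝ)) atTop atTop := tendsto_natCast_atTop_atTop.comp hm
  have hlim : Tendsto (fun j => (n j : ℝ) / (m j : ℝ)) atTop (𝓝 α) := by
    have h1 : Tendsto (fun j => (1 : ℝ) / m j) atTop (𝓝 0) := tendsto_const_nhds.div_atTop hmr
    have h2 : Tendsto (fun j => (⌊α * m j⌋₊ : ℝ) / m j) atTop (𝓝 α) :=
      (tendsto_nat_floor_mul_div_atTop hα.1).comp hmr
    have h3 := h1.max h2
    rw [max_eq_right hα.1] at h3
    refine h3.congr fun j => ?_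
    rw [max_div_div_right (Nat.cast_nonneg (m j))]
    simp [n, m]
  have hnonneg : ∀ k, 0 ≤ q.limit α k := fun k =>
    ge_of_tendsto' (q.tendsto_prob hnm hm hlim k) fun j => measureReal_nonneg
  refine ⟨hnonneg, ?_⟩
  obtain ⟨h1, h2⟩ := q.tendsto_tsum hnm hm hlim (g := fun _ => 1) (K := 1) (s := 0) zero_le_one
    (fun k => by simp)
  have h3 : ∀ j, ∑' k, (sampleMeasure (m j) (n j)).real {ω | q.value ω = k} * 1 = 1 := by
    intro j
    rw [← integral_comp_eq_tsum (g := fun _ => 1) q.measurable_value Integrable.of_finite]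
    simp
  have h4 : ∑' k, q.limit α k * 1 = 1 :=
    tendsto_nhds_unique (h2.congr h3) tendsto_const_nhds
  simp only [mul_one, abs_one] at h1 h4
  rw [← h4]
  exact h1.hasSum

end Limits

end CoalescedHashing

open CoalescedHashing
theorem theorem1 :
    (∀ (q : Quantity) (α : ℝ), α ∈ Set.Icc (0 : ℝ) 1 →
      (∀ k, 0 ≤ q.limit α k) ∧ HasSum (q.limit α) 1) ∧
    ∀ (m n : ℕ → ℕ) [∀ j, NeZero (m j)] [∀ j, NeZero (n j)] (α : ℝ),
      α ∈ Set.Icc (0 : ℝ) 1 → (∀ j, n j ≤ m j) →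
      Tendsto m atTop atTop → Tendsto n atTop atTop →
      Tendsto (fun j => (n j : ℝ) / (m j : ℝ)) atTop (𝓝 α) →
      ∀ q : Quantity,
        (∀ k : ℕ,
          (∀ j, (sampleMeasure (m j) (n j)).real {ω | q.value ω = k} =
            1 / (q.size (m j) (n j) : ℝ) *
              ∫ ω, (q.count ω.1 k : ℝ) ∂(sampleMeasure (m j) (n j))) ∧
          Tendsto (fun j => (sampleMeasure (m j) (n j)).real {ω | q.value ω = k}) atTop
            (𝓝 (q.limit α k))) ∧
        ∀ {Ω : Type*} [MeasurableSpace Ω] (P : Measure Ω) [IsProbabilityMeasure P] (D : Ω → ℕ),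
          Measurable D → (∀ k, P.real {ω | D ω = k} = q.limit α k) →
          TendstoInDistribution (fun j (ω : Sample (m j) (n j)) => q.value ω) atTop D
            (fun j => sampleMeasure (m j) (n j)) P ∧
          ∀ r : ℝ, 0 ≤ r →
            Integrable (fun ω => (D ω : ℝ) ^ r) P ∧
            (∀ j, Integrable (fun ω => (q.value ω : ℝ) ^ r) (sampleMeasure (m j) (n j))) ∧
            Tendsto (fun j => ∫ ω, (q.value ω : ℝ) ^ r ∂(sampleMeasure (m j) (n j))) atTop
              (𝓝 (∫ ω, (D ω : ℝ) ^ r ∂P)) := by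
  refine ⟨fun q α hα => q.limit_isProbability hα, ?_⟩
  intro m n _ _ α _ hnm hm _ hlim q
  refine ⟨fun k => ⟨fun j => q.prob_eq_integral_count k, q.tendsto_prob hnm hm hlim k⟩, ?_⟩
  intro Ω _ P _ D hD hP
  refine ⟨⟨fun j => q.measurable_value.aemeasurable, hD.aemeasurable, ?_⟩, fun r hr => ?_⟩
  · refine ProbabilityMeasure.tendsto_iff_forall_integral_tendsto.2 fun f => ?_
    have h := (q.tendsto_integral hnm hm hlim hD hP (g := f) (K := ‖f‖) (s := 0) (norm_nonneg f)
      (fun k => by simpa using f.norm_coe_le_norm k)).2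
    simp only [ProbabilityMeasure.coe_mk]
    rw [integral_map hD.aemeasurable f.continuous.aestronglyMeasurable]
    refine h.congr fun j => ?_
    rw [integral_map q.measurable_value.aemeasurable f.continuous.aestronglyMeasurable]
  -- A real power is dominated by `(k + 1) ^ ⌈r⌉₊`; the shift makes the base at least `1`, so that
  -- raising the exponent increases the power.
  · obtain ⟨h1, h2⟩ := q.tendsto_integral hnm hm hlim hD hP (g := fun k => (k : ℝ) ^ r) (K := 1)
      (s := ⌈r⌉₊) zero_le_one (fun k => by
        have hk : (0 : ℝ) ≤ k := Nat.cast_nonneg k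
        rw [abs_of_nonneg (Real.rpow_nonneg hk r), one_mul, ← Real.rpow_natCast]
        exact (Real.rpow_le_rpow hk (by linarith) hr).trans
          (Real.rpow_le_rpow_of_exponent_le (by linarith) (Nat.le_ceil r)))
    exact ⟨h1, fun j => Integrable.of_finite, h2⟩
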